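/- Let $1 \le k \le n$ be integers and put $t = n+1-k$. Let $S^{2n} = \{(z_1,\dots,z_n,x) \in \mathbb{C}^n\times\mathbb{R} : |z_1|^2+\cdots+|z_n|^2+x^2 = 1\}$ with the standard action of the torus $T^n$ on the coordinates $z_1,\dots,z_n$, and let $\pi(z_1,\dots,z_n,x) = (|z_1|,\dots,|z_n|,x)$ be its orbit map onto $Q^n = \{(x_1,\dots,x_n,x)\in\mathbb{R}^{n+1} : x_1^2+\cdots+x_n^2+x^2=1,\ x_i\ge 0 \text{ for } 1\le i\le n\}$. The faces of $Q^n$ are $Q^n$ itself, the sets $\{x_i = 0 \text{ for all } i\in I\}\subseteq Q^n$ with $I\subset\{1,\dots,n\}$ and $0<|I|<n$, and the two vertices $(0,\dots,0,\pm1)$; the edge $E_j$ is the set of points of $Q^n$ with $x_i=0$ for all $i\ne j$. Let $V([n],k)$ be the union of all faces of $Q^n$ that do not contain all of the edges $E_k,\dots,E_n$, and let $U([n],k)=\pi^{-1}(V([n],k))\subseteq S^{2n}$. Then there is a homotopy equivalence $$U([n],k)\;\simeq\;\bigvee_{i=1}^{t}\ \bigvee_{\binom{t}{i}} S^{2n-1-i}.$$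 Moreover, for every $T^n$-orbit $O\subset S^{2n}$ of dimension $t$ (the orbit of a point with exactly $t$ nonzero coordinates among $z_1,\dots,z_n$), the complement $S^{2n}\setminus O$ is homotopy equivalent to the same wedge of spheres. -/

import Mathlib

open scoped ContinuousMap

noncomputable section

namespace TorusComplement

/-- The sphere `S^{2n} = {(z, x) ∈ ℂⁿ × ℝ : |z₁|² + ⋯ + |zₙ|² + x² = 1}`. -/
def evenSphere (n : ℕ) : Set ((Fin n → ℂ) × ℝ) :=
  {p | ∑ j, ‖p.1 j‖ ^ 2 + p.2 ^ 2 = 1}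

/-- The orbit space `Qⁿ` of `S^{2n}`. -/
def orbitSpace (n : ℕ) : Set ((Fin n → ℝ) × ℝ) :=
  {y | ∑ j, y.1 j ^ 2 + y.2 ^ 2 = 1 ∧ ∀ j, 0 ≤ y.1 j}

/-- The map `π (z, x) = (|z₁|, …, |zₙ|, x)`. -/
def orbitMap (n : ℕ) (p : (Fin n → ℂ) × ℝ) : (Fin n → ℝ) × ℝ :=
  (fun j => ‖p.1 j‖, p.2)

/-- The standard action of the torus `Tⁿ` on `ℂⁿ × ℝ`, which preserves `S^{2n}`. -/
def torusAct {n : ℕ} (t : Fin n → Circle) (p : (Fin n → ℂ) × ℝ) : (Fin n → ℂ) × ℝ :=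
  (fun j => (t j : ℂ) * p.1 j, p.2)

/-- The `Tⁿ`-orbit of a point. It is a torus whose dimension is the number of nonzero
coordinates among `z₁, …, zₙ`. -/
def torusOrbit {n : ℕ} (p : (Fin n → ℂ) × ℝ) : Set ((Fin n → ℂ) × ℝ) :=
  Set.range fun t : Fin n → Circle => torusAct t p

/-- The dimension of the `Tⁿ`-orbit of a point, that is, the dimension of the face of `Qⁿ` in
whose relative interior the image of the point lies. -/
def orbitDim {n : ℕ} (p : (Fin n → ℂ) × ℝ) : ℕ :=
  Set.ncard {j : Fin n | p.1 j ≠ 0}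

/-- The faces of `Qⁿ`: `Qⁿ` itself, the faces of codimension `c` with `0 < c < n`, each cut out
by the vanishing of `c` of the first `n` coordinates, and the two vertices `(0, …, 0, ±1)`. -/
def IsFace (n : ℕ) (F : Set ((Fin n → ℝ) × ℝ)) : Prop :=
  F = orbitSpace n ∨
  (∃ I : Finset (Fin n), 0 < I.card ∧ I.card < n ∧
    F = {y | y ∈ orbitSpace n ∧ ∀ i ∈ I, y.1 i = 0}) ∨
  F = {(0, 1)} ∨ F = {(0, -1)}

/-- The edge `E_{j+1} = {(0, …, 0, x_{j+1}, 0, …, 0, x)}` of `Qⁿ` (indices in `Fin n` start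
at `0`). -/
def edge {n : ℕ} (j : Fin n) : Set ((Fin n → ℝ) × ℝ) :=
  {y | y ∈ orbitSpace n ∧ ∀ i, i ≠ j → y.1 i = 0}

/-- The family `ℒ(n, k)`: all faces of `Qⁿ` if `k = 0`, and for `k ≥ 1` those faces that do not
contain all of the edges `E_k, …, E_n`. -/
def faceFamily (n k : ℕ) : Set (Set ((Fin n → ℝ) × ℝ)) :=
  {F | IsFace n F ∧ (1 ≤ k → ¬ ∀ j : Fin n, k ≤ (j : ℕ) + 1 → edge j ⊆ F)}

/-- `V([n], k)`, the union of the faces in `ℒ(n, k)`. -/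
def V (n k : ℕ) : Set ((Fin n → ℝ) × ℝ) :=
  ⋃₀ faceFamily n k

/-- `U([n], k) = π⁻¹(V([n], k)) ⊆ S^{2n}`. -/
def U (n k : ℕ) : Set ((Fin n → ℂ) × ℝ) :=
  {p | p ∈ evenSphere n ∧ orbitMap n p ∈ V n k}

/-- The standard sphere `S^m`, the unit sphere of `ℝ^{m+1}`. -/
abbrev StdSphere (m : ℕ) : Type :=
  Metric.sphere (0 : EuclideanSpace ℝ (Fin (m + 1))) 1

/-- The base point `(1, 0, …, 0)` of `S^m`. -/
def basePt (m : ℕ) : StdSphere m :=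
  ⟨EuclideanSpace.single 0 1, by simp⟩

/-- Every base point `x₀ i` is glued to one additional point. -/
inductive WedgeRel {ι : Type} {X : ι → Type} (x₀ : ∀ i, X i) :
    Unit ⊕ (Σ i, X i) → Unit ⊕ (Σ i, X i) → Prop
  | glue (i : ι) : WedgeRel x₀ (Sum.inr ⟨i, x₀ i⟩) (Sum.inl ())

/-- The wedge of a family of pointed spaces, with the quotient topology: the disjoint union of
the spaces, with all base points identified. -/
abbrev Wedge {ι : Type} {X : ι → Type} (x₀ : ∀ i, X i) : Type :=
  Quot (WedgeRel x₀)

/-- The wedge over `i = 1, …, t` of `t.choose i` copies of `S^{2n-1-i}`. -/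
abbrev SphereWedge (n t : ℕ) : Type :=
  Wedge (X := fun a : (Σ i : Finset.Icc 1 t, Fin (t.choose i)) => StdSphere (2 * n - 1 - a.1))
    (fun a => basePt (2 * n - 1 - a.1))

end TorusComplement

end

/-! Both spaces are compared with the set X_J of points of S^{2n} having z_j = 0 for some j in J,
where |J| = t. The space U([n],k) equals X_J for J = {k, …, n}: a face cut out by an index set K
contains all of E_k, …, E_n exactly when K misses J (`U_eq_sphereHyperplanes`). The complement of
the orbit of p deforms onto X_J for J the support of p: subtract from q the largest multiple of the
orbit point with the arguments of q that the moduli allow, then project back to the sphere. Only a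
point of the orbit could meet zero or the orbit on the way (`mem_torusOrbit_of_push`,
`nonempty_homotopyEquiv_complement`).

It remains to compute X_J. Stereographic projection identifies it with the one-point
compactification of H_t × ℂ^{n-t}, where H_t is the union of the coordinate hyperplanes of ℂ^t. So
spaces are studied up to pointed homotopy equivalence of their compactifications (`ProperEquiv`,
written ~ below); disjoint unions then become wedges and Euclidean spaces become spheres.

The engine is `ProperEquiv.detach`: if a closed subset A can be moved properly to infinity inside D,
then (A × S) ∪ (D × 0) ~ A × (S \ 0) ⊔ D for a closed cone S. Applied to H_{t+1} = (H_t × ℂ) ∪ (ℂ^t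
× 0), with H_t escaping along the diagonal, it leaves H_t × ℂˣ and ℂ^t. Applied in two ways to a ray
and a plane glued at their apex, it gives B × ℂˣ ~ B × ℝ ⊔ B × ℂ (`ProperEquiv.prod_puncture`).
Hence H_{t+1} × V ~ H_t × V × ℝ ⊔ H_t × V × ℂ ⊔ ℂ^t × V, and induction with Pascal's rule yields
binom(t, i) cells of dimension 2t + dim V - 1 - i (`ProperEquiv.coordHyperplanes_cells`). -/

namespace TorusComplement

open Set Filter Topology
open scoped ContinuousMap OnePoint unitInterval

/-! ### One-point compactifications and homotopies relative to ∞. -/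

variable {X Y Z W Z' W' V T : Type*} [TopologicalSpace X] [TopologicalSpace Y]
  [TopologicalSpace Z] [TopologicalSpace W] [TopologicalSpace Z'] [TopologicalSpace W']
  [TopologicalSpace V] [TopologicalSpace T]

/-- The one-point compactifications of `Z` and `W` are homotopy equivalent relative to `∞`. -/
def ProperEquiv (Z W : Type*) [TopologicalSpace Z] [TopologicalSpace W] : Prop :=
  ∃ (f : C(OnePoint Z, OnePoint W)) (g : C(OnePoint W, OnePoint Z)), f ∞ = ∞ ∧ g ∞ = ∞ ∧
    (g.comp f).HomotopicRel (.id _) {∞} ∧ (f.comp g).HomotopicRel (.id _) {∞}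

theorem homotopicRel_comp_right {f₀ f₁ : C(OnePoint Z, OnePoint W)}
    (H : f₀.HomotopicRel f₁ {∞}) (h : C(OnePoint V, OnePoint Z)) (hh : h ∞ = ∞) :
    (f₀.comp h).HomotopicRel (f₁.comp h) {∞} := by
  obtain ⟨F⟩ := H
  refine ⟨⟨⟨⟨fun p => F (p.1, h p.2), by fun_prop⟩, ?_, ?_⟩, ?_⟩⟩
  · intro x; simp
  · intro x; simp
  · rintro t x rfl
    have := F.eq_fst t (x := ∞) rfl
    simpa [hh] using this

theorem ProperEquiv.symm (h : ProperEquiv Z W) : ProperEquiv W Z := by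
  obtain ⟨f, g, hf, hg, h1, h2⟩ := h
  exact ⟨g, f, hg, hf, h2, h1⟩

theorem homotopicRel_comp_comp {f : C(OnePoint Z, OnePoint W)} {g : C(OnePoint W, OnePoint Z)}
    {f' : C(OnePoint W, OnePoint V)} {g' : C(OnePoint V, OnePoint W)} (hf : f ∞ = ∞)
    (h : (g.comp f).HomotopicRel (.id _) {∞}) (h' : (g'.comp f').HomotopicRel (.id _) {∞}) :
    ((g.comp g').comp (f'.comp f)).HomotopicRel (.id _) {∞} :=
  ((homotopicRel_comp_right h' f hf).comp_continuousMap g).trans h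

theorem ProperEquiv.trans (h : ProperEquiv Z W) (h' : ProperEquiv W V) : ProperEquiv Z V := by
  obtain ⟨f, g, hf, hg, h1, h2⟩ := h
  obtain ⟨f', g', hf', hg', h1', h2'⟩ := h'
  exact ⟨f'.comp f, g.comp g', by simp [hf, hf'], by simp [hg, hg'],
    homotopicRel_comp_comp hf h1 h1', homotopicRel_comp_comp hg' h2' h2⟩

theorem ProperEquiv.of_homeomorph (e : Z ≃ₜ W) : ProperEquiv Z W := by
  refine ⟨⟨e.onePointCongr, e.onePointCongr.continuous⟩,
    ⟨e.onePointCongr.symm, e.onePointCongr.symm.continuous⟩, rfl, rfl, ?_, ?_⟩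
  · have : (ContinuousMap.id (OnePoint Z)) = ContinuousMap.comp
      ⟨e.onePointCongr.symm, e.onePointCongr.symm.continuous⟩
      ⟨e.onePointCongr, e.onePointCongr.continuous⟩ := by ext x; simp
    rw [this]
    exact .refl _
  · have : (ContinuousMap.id (OnePoint W)) = ContinuousMap.comp
      ⟨e.onePointCongr, e.onePointCongr.continuous⟩
      ⟨e.onePointCongr.symm, e.onePointCongr.symm.continuous⟩ := by ext x; simp
    rw [this]
    exact .refl _

theorem ProperEquiv.refl (Z : Type*) [TopologicalSpace Z] : ProperEquiv Z Z :=
  .of_homeomorph (.refl Z)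

theorem ProperEquiv.nonempty_homotopyEquiv (h : ProperEquiv Z W) :
    Nonempty (OnePoint Z ≃ₕ OnePoint W) := by
  obtain ⟨f, g, hf, hg, h1, h2⟩ := h
  exact ⟨⟨f, g, h1.homotopic, h2.homotopic⟩⟩

/-- A family of partial maps `Z → W` is proper if the preimages of a compact set lie in a common
compact set. -/
def ProperFamily (F : T × Z → OnePoint W) : Prop :=
  ∀ K : Set W, IsCompact K → ∃ K' : Set Z, IsCompact K' ∧
    ∀ t z, ∀ w ∈ K, F (t, z) = (w : OnePoint W) → z ∈ K'

/-- The extension of a family of partial maps to one-point compactifications. -/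
def extendInfty (F : T × Z → OnePoint W) (p : T × OnePoint Z) : OnePoint W :=
  p.2.elim ∞ fun z => F (p.1, z)

/-- The compact set in `ProperFamily` does not depend on the parameter, so its closure's complement
times all of `T` is a neighbourhood of `(t, ∞)` that avoids the preimage of `K`. -/
theorem continuous_extendInfty [R1Space Z] {F : T × Z → OnePoint W} (hF : Continuous F)
    (hp : ProperFamily F) : Continuous (extendInfty F) := by
  rw [continuous_iff_continuousAt]
  rintro ⟨t, z⟩
  induction z using OnePoint.rec with
  | coe z =>
    have he : IsOpenEmbedding (Prod.map id (↑) : T × Z → T × OnePoint Z) :=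
      IsOpenEmbedding.id.prodMap OnePoint.isOpenEmbedding_coe
    exact (he.continuousAt_iff (x := (t, z)) (g := extendInfty F)).1 hF.continuousAt
  | infty =>
    change Tendsto _ _ (𝓝 ∞)
    rw [OnePoint.hasBasis_nhds_infty.tendsto_right_iff]
    rintro K ⟨-, hK⟩
    obtain ⟨K', hK', h⟩ := hp K hK
    have : (univ : Set T) ×ˢ (((↑) '' (closure K')ᶜ ∪ {∞}) : Set (OnePoint Z)) ∈
        𝓝 (t, (∞ : OnePoint Z)) :=
      prod_mem_nhds univ_mem
        (OnePoint.hasBasis_nhds_infty.mem_of_mem ⟨isClosed_closure, hK'.closure⟩)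
    filter_upwards [this]
    rintro ⟨t', z'⟩ ⟨-, hz | hz⟩
    · obtain ⟨z, hz, rfl⟩ := hz
      by_contra hc
      have hc' : F (t', z) ∉ ((↑) '' Kᶜ ∪ {∞} : Set (OnePoint W)) := hc
      rw [← OnePoint.compl_image_coe, notMem_compl_iff] at hc'
      obtain ⟨w, hw, hw'⟩ := hc'
      exact hz (subset_closure (h t' z w hw hw'.symm))
    · cases hz
      exact Or.inr rfl

theorem exists_continuousMap_onePoint [R1Space Z] {f : Z → OnePoint W} (hf : Continuous f)
    (hp : ProperFamily fun p : Unit × Z => f p.2) :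
    ∃ g : C(OnePoint Z, OnePoint W), g ∞ = ∞ ∧ ∀ z : Z, g z = f z :=
  ⟨⟨fun z => extendInfty (fun p : Unit × Z => f p.2) ((), z),
    (continuous_extendInfty (by fun_prop) hp).comp (by fun_prop)⟩, rfl, fun _ => rfl⟩

theorem homotopicRel_of_properFamily [R1Space Z] {f₀ f₁ : C(OnePoint Z, OnePoint W)}
    (h₀ : f₀ ∞ = ∞) (h₁ : f₁ ∞ = ∞) {F : I × Z → OnePoint W} (hF : Continuous F)
    (hp : ProperFamily F) (hF₀ : ∀ z, F (0, z) = f₀ z) (hF₁ : ∀ z, F (1, z) = f₁ z) :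
    f₀.HomotopicRel f₁ {∞} := by
  refine ⟨⟨⟨⟨extendInfty F, continuous_extendInfty hF hp⟩, ?_, ?_⟩, ?_⟩⟩
  · intro z
    induction z using OnePoint.rec with
    | coe z => exact hF₀ z
    | infty => exact h₀.symm
  · intro z
    induction z using OnePoint.rec with
    | coe z => exact hF₁ z
    | infty => exact h₁.symm
  · rintro t z rfl
    exact h₀.symm

open Classical in
/-- The map that collapses the complement of an open set to a point. -/
noncomputable def collapse (U : Set X) (x : X) : OnePoint U :=
  if h : x ∈ U then ((⟨x, h⟩ : U) : OnePoint U) else ∞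

omit [TopologicalSpace X] in
theorem collapse_of_mem {U : Set X} {x : X} (h : x ∈ U) :
    collapse U x = ((⟨x, h⟩ : U) : OnePoint U) := dif_pos h

omit [TopologicalSpace X] in
theorem collapse_of_notMem {U : Set X} {x : X} (h : x ∉ U) : collapse U x = ∞ := dif_neg h

/-- At a point outside `U`, a compact `K ⊆ U` is closed in the Hausdorff space `X`, so nearby points
avoid it. -/
theorem continuous_collapse [T2Space X] {U : Set X} (hU : IsOpen U) :
    Continuous (collapse U) := by
  rw [continuous_iff_continuousAt]
  intro x
  by_cases hx : x ∈ U
  · have he : IsOpenEmbedding ((↑) : U → X) := hU.isOpenEmbedding_subtypeVal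
    rw [← he.continuousAt_iff (x := ⟨x, hx⟩)]
    have : collapse U ∘ ((↑) : U → X) = ((↑) : U → OnePoint U) := by
      ext y; exact collapse_of_mem y.2
    rw [this]
    exact OnePoint.continuous_coe.continuousAt
  · rw [ContinuousAt, collapse_of_notMem hx, OnePoint.hasBasis_nhds_infty.tendsto_right_iff]
    rintro K ⟨-, hK⟩
    have hK' : IsClosed (((↑) : U → X) '' K) := (hK.image continuous_subtype_val).isClosed
    have hx' : x ∉ ((↑) : U → X) '' K := by
      rintro ⟨y, -, rfl⟩
      exact hx y.2
    filter_upwards [hK'.isOpen_compl.mem_nhds hx'] with y hy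
    by_cases hyU : y ∈ U
    · rw [collapse_of_mem hyU]
      exact Or.inl ⟨_, fun h => hy ⟨_, h, rfl⟩, rfl⟩
    · rw [collapse_of_notMem hyU]
      exact Or.inr rfl

/-! ### Disjoint unions compactify to wedges. -/

section Sum

instance [LocallyCompactSpace Z] [LocallyCompactSpace W] :
    WeaklyLocallyCompactSpace (Z ⊕ W) where
  exists_compact_mem_nhds := by
    rintro (z | z)
    · obtain ⟨K, hK, hz⟩ := exists_compact_mem_nhds z
      exact ⟨_, hK.image continuous_inl, isOpenMap_inl.image_mem_nhds hz⟩
    · obtain ⟨K, hK, hz⟩ := exists_compact_mem_nhds z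
      exact ⟨_, hK.image continuous_inr, isOpenMap_inr.image_mem_nhds hz⟩

instance {ι : Type*} {X : ι → Type*} [∀ i, TopologicalSpace (X i)]
    [∀ i, LocallyCompactSpace (X i)] : WeaklyLocallyCompactSpace (Σ i, X i) where
  exists_compact_mem_nhds := by
    rintro ⟨i, z⟩
    obtain ⟨K, hK, hz⟩ := exists_compact_mem_nhds z
    exact ⟨_, hK.image continuous_sigmaMk, isOpenMap_sigmaMk.image_mem_nhds hz⟩

/-- The one-point compactification of a closed subspace inside that of the whole space. -/
def onePointMap {f : X → Y} (hf : IsClosedEmbedding f) : C(OnePoint X, OnePoint Y) where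
  toFun := OnePoint.map f
  continuous_toFun := OnePoint.continuous_map hf.continuous <| by
    rw [hasBasis_coclosedCompact.tendsto_right_iff]
    rintro K ⟨hK, hK'⟩
    exact (hf.isCompact_preimage hK').compl_mem_coclosedCompact_of_isClosed
      (hK.preimage hf.continuous)

@[simp] theorem onePointMap_infty {f : X → Y} (hf : IsClosedEmbedding f) :
    onePointMap hf ∞ = ∞ := rfl

@[simp] theorem onePointMap_coe {f : X → Y} (hf : IsClosedEmbedding f) (x : X) :
    onePointMap hf x = f x := rfl

/-- The map out of a wedge of one-point compactifications. -/
def wedgeElim (a : OnePoint Z → Y) (b : OnePoint Z' → Y) (p : OnePoint (Z ⊕ Z')) : Y :=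
  p.elim (a ∞) (Sum.elim (fun z => a z) fun z => b z)

theorem continuous_wedgeElim [LocallyCompactSpace Z] [T2Space Z] [LocallyCompactSpace Z']
    [T2Space Z'] {a : T × OnePoint Z → Y} {b : T × OnePoint Z' → Y} (ha : Continuous a)
    (hb : Continuous b) (hab : ∀ t, a (t, ∞) = b (t, ∞)) :
    Continuous fun p : T × OnePoint (Z ⊕ Z') =>
      wedgeElim (fun z => a (p.1, z)) (fun z => b (p.1, z)) p.2 := by
  let q : OnePoint Z ⊕ OnePoint Z' → OnePoint (Z ⊕ Z') :=
    Sum.elim (onePointMap .inl) (onePointMap .inr)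
  have hq : Continuous q := by fun_prop
  have hqs : Function.Surjective q := by
    intro p
    induction p using OnePoint.rec with
    | infty => exact ⟨.inl ∞, rfl⟩
    | coe p =>
      cases p with
      | inl z => exact ⟨.inl z, rfl⟩
      | inr z => exact ⟨.inr z, rfl⟩
  -- A product of a quotient map with an identity need not be a quotient map. Here `q` goes from a
  -- compact to a Hausdorff space, so it is proper, and its product with any `T` is closed.
  have hQ : IsQuotientMap (Prod.map id q : T × _ → T × _) := by
    have h1 : IsProperMap (Prod.map (id : T → T) q) := isProperMap_id.prodMap hq.isProperMap
    exact h1.isClosedMap.isQuotientMap h1.continuous (Function.surjective_id.prodMap hqs)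
  rw [hQ.continuous_iff]
  let e : T × (OnePoint Z ⊕ OnePoint Z') ≃ₜ (T × OnePoint Z) ⊕ (T × OnePoint Z') :=
    Homeomorph.prodSumDistrib
  have : Continuous (Sum.elim a b ∘ e) := by fun_prop
  convert this using 1
  ext ⟨t, z | z⟩
  · induction z using OnePoint.rec <;> rfl
  · induction z using OnePoint.rec
    · exact hab t
    · rfl

/-- The wedge of two maps of one-point compactifications. -/
def wedgeMap [LocallyCompactSpace Z] [T2Space Z] [LocallyCompactSpace Z'] [T2Space Z']
    (f : C(OnePoint Z, OnePoint W)) (f' : C(OnePoint Z', OnePoint W')) (h : f ∞ = ∞)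
    (h' : f' ∞ = ∞) : C(OnePoint (Z ⊕ Z'), OnePoint (W ⊕ W')) where
  toFun := wedgeElim (fun z => onePointMap .inl (f z)) (fun z => onePointMap .inr (f' z))
  continuous_toFun := by
    have := continuous_wedgeElim (T := Unit) (Z := Z) (Z' := Z')
      (a := fun z => onePointMap (.inl : IsClosedEmbedding (Sum.inl : W → W ⊕ W')) (f z.2))
      (b := fun z => onePointMap .inr (f' z.2)) (by fun_prop) (by fun_prop) (by simp [h, h'])
    exact this.comp (f := fun p => ((), p)) (by fun_prop)

/-- The two homotopies glue because both fix `∞` at all times; this is why `ProperEquiv` asks for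
homotopies relative to `∞`. -/
theorem homotopicRel_wedge [LocallyCompactSpace Z] [T2Space Z] [LocallyCompactSpace Z']
    [T2Space Z'] {f : C(OnePoint Z, OnePoint W)} {g : C(OnePoint W, OnePoint Z)}
    {f' : C(OnePoint Z', OnePoint W')} {g' : C(OnePoint W', OnePoint Z')}
    [LocallyCompactSpace W] [T2Space W] [LocallyCompactSpace W'] [T2Space W']
    (hf : f ∞ = ∞) (hg : g ∞ = ∞) (hf' : f' ∞ = ∞) (hg' : g' ∞ = ∞)
    (h : (g.comp f).HomotopicRel (.id _) {∞}) (h' : (g'.comp f').HomotopicRel (.id _) {∞}) :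
    ((wedgeMap g g' hg hg').comp (wedgeMap f f' hf hf')).HomotopicRel (.id _) {∞} := by
  obtain ⟨F⟩ := h
  obtain ⟨F'⟩ := h'
  have hF : ∀ t, F (t, ∞) = ∞ := fun t => by simpa using F.eq_snd t (x := ∞) rfl
  have hF' : ∀ t, F' (t, ∞) = ∞ := fun t => by simpa using F'.eq_snd t (x := ∞) rfl
  have key := continuous_wedgeElim (Z := Z) (Z' := Z')
    (a := fun z : I × _ => onePointMap (.inl : IsClosedEmbedding (Sum.inl : Z → Z ⊕ Z')) (F z))
    (b := fun z => onePointMap .inr (F' z)) (by fun_prop) (by fun_prop) (by simp [hF, hF'])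
  refine ⟨⟨⟨⟨_, key⟩, ?_, ?_⟩, ?_⟩⟩
  · intro p
    induction p using OnePoint.rec with
    | infty => simp [wedgeElim, wedgeMap, hf, hg]
    | coe p =>
      cases p with
      | inl z =>
        simp only [wedgeElim, wedgeMap, OnePoint.elim_some, Sum.elim_inl,
          ContinuousMap.comp_apply, ContinuousMap.coe_mk, F.apply_zero]
        induction f z using OnePoint.rec <;> simp [hg]
      | inr z =>
        simp only [wedgeElim, wedgeMap, OnePoint.elim_some, Sum.elim_inr,
          ContinuousMap.comp_apply, ContinuousMap.coe_mk, F'.apply_zero]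
        induction f' z using OnePoint.rec <;> simp [hg, hg']
  · intro p
    induction p using OnePoint.rec with
    | infty => simp [wedgeElim]
    | coe p => cases p <;> simp [wedgeElim]
  · rintro t p rfl
    simp [wedgeElim, wedgeMap, hF, hf, hg]

theorem ProperEquiv.sum [LocallyCompactSpace Z] [T2Space Z] [LocallyCompactSpace Z']
    [T2Space Z'] [LocallyCompactSpace W] [T2Space W] [LocallyCompactSpace W'] [T2Space W']
    (h : ProperEquiv Z W) (h' : ProperEquiv Z' W') : ProperEquiv (Z ⊕ Z') (W ⊕ W') := by
  obtain ⟨f, g, hf, hg, h1, h2⟩ := h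
  obtain ⟨f', g', hf', hg', h1', h2'⟩ := h'
  exact ⟨wedgeMap f f' hf hf', wedgeMap g g' hg hg', by simp [wedgeMap, wedgeElim, hf],
    by simp [wedgeMap, wedgeElim, hg], homotopicRel_wedge hf hg hf' hg' h1 h1',
    homotopicRel_wedge hg hf hg' hf' h2 h2'⟩

end Sum

/-- If the points of `Z` can be pushed to infinity, then the one-point compactification of `Z` is
contractible. -/
theorem ProperEquiv.empty [R1Space Z] {F : I × Z → OnePoint Z} (hF : Continuous F)
    (hp : ProperFamily F) (hF₀ : ∀ z, F (0, z) = ∞) (hF₁ : ∀ z, F (1, z) = z) :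
    ProperEquiv Z Empty := by
  refine ⟨.const _ ∞, .const _ ∞, rfl, rfl, ?_, ?_⟩
  · exact homotopicRel_of_properFamily rfl rfl hF hp hF₀ hF₁
  · have : (ContinuousMap.const (OnePoint Z) (∞ : OnePoint Empty)).comp
        (ContinuousMap.const _ ∞) = .id _ := by
      ext x
      exact Subsingleton.elim _ _
    rw [this]
    exact .refl _

end TorusComplement

/-! ### Radial contraction in ℂ. -/

namespace TorusComplement

open Set Filter Topology
open scoped ContinuousMap OnePoint unitInterval

/-- Radial soft thresholding: the norm of `w` is decreased by `|h|`, but not below `0`. -/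
noncomputable def soft (h : ℝ) (w : ℂ) : ℂ := (1 - min |h| ‖w‖ / ‖w‖) • w

theorem norm_soft (h : ℝ) (w : ℂ) : ‖soft h w‖ = ‖w‖ - min |h| ‖w‖ := by
  rcases eq_or_ne w 0 with rfl | hw
  · simp [soft]
  · have hw' : 0 < ‖w‖ := norm_pos_iff.2 hw
    have h1 : min |h| ‖w‖ / ‖w‖ ≤ 1 := (div_le_one hw').2 (min_le_right _ _)
    rw [soft, norm_smul, Real.norm_of_nonneg (by linarith)]
    field_simp

theorem norm_soft_le (h : ℝ) (w : ℂ) : ‖soft h w‖ ≤ ‖w‖ := by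
  rw [norm_soft]
  have : 0 ≤ min |h| ‖w‖ := by positivity
  linarith

theorem norm_soft_of_le {h : ℝ} {w : ℂ} (h0 : 0 ≤ h) (hw : h ≤ ‖w‖) :
    ‖soft h w‖ = ‖w‖ - h := by
  rw [norm_soft, abs_of_nonneg h0, min_eq_left hw]

theorem soft_eq_zero {h : ℝ} {w : ℂ} (hw : ‖w‖ ≤ h) : soft h w = 0 := by
  rw [← norm_eq_zero, norm_soft, min_eq_right (hw.trans (le_abs_self h)), sub_self]

@[simp] theorem soft_zero_left (w : ℂ) : soft 0 w = w := by
  simp [soft]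

theorem soft_eq_smul {h : ℝ} {w : ℂ} (h0 : 0 ≤ h) (hw : h ≤ ‖w‖) :
    soft h w = (1 - h / ‖w‖) • w := by
  rw [soft, abs_of_nonneg h0, min_eq_left hw]

theorem exists_soft_eq_smul (h : ℝ) (w : ℂ) : ∃ c : ℝ, 0 ≤ c ∧ soft h w = c • w := by
  refine ⟨_, ?_, rfl⟩
  have : min |h| ‖w‖ / ‖w‖ ≤ 1 := div_le_one_of_le₀ (min_le_right _ _) (norm_nonneg _)
  linarith

theorem soft_soft {a b : ℝ} {w : ℂ} (ha : 0 ≤ a) (hb : 0 ≤ b) (hab : a + b ≤ ‖w‖) :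
    soft a (soft b w) = soft (a + b) w := by
  rcases eq_or_ne w 0 with rfl | hw
  · simp [soft]
  have hw' : 0 < ‖w‖ := norm_pos_iff.2 hw
  rcases eq_or_lt_of_le (show b ≤ ‖w‖ by linarith) with h | h
  · have : a = 0 := by linarith
    simp [this]
  have hn : ‖soft b w‖ = ‖w‖ - b := norm_soft_of_le hb h.le
  rw [soft_eq_smul ha (by rw [hn]; linarith), hn, soft_eq_smul hb h.le,
    soft_eq_smul (by positivity) hab, smul_smul]
  congr 1
  have : ‖w‖ - b ≠ 0 := by linarith
  field_simp
  ring

/-- The formula divides by `‖w‖`; at `w = 0` continuity follows instead from `‖soft h w‖ ≤ ‖w‖`. -/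
theorem continuous_soft : Continuous fun p : ℝ × ℂ => soft p.1 p.2 := by
  rw [continuous_iff_continuousAt]
  rintro ⟨h, w⟩
  rcases eq_or_ne w 0 with rfl | hw
  · have h0 : soft h 0 = 0 := by simp [soft]
    rw [ContinuousAt, h0]
    refine squeeze_zero_norm (fun p => norm_soft_le p.1 p.2) ?_
    have : Continuous fun p : ℝ × ℂ => ‖p.2‖ := by fun_prop
    simpa using this.tendsto (h, 0)
  · have : ‖((h, w) : ℝ × ℂ).2‖ ≠ 0 := norm_ne_zero_iff.2 hw
    unfold soft
    fun_prop (disch := assumption)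

/-! ### Paths that escape to infinity. -/

section Flow

variable {D : Type*} [TopologicalSpace D]

/-- A semiflow on `D` that moves the points of `A` properly to infinity. -/
structure IsEscapingFlow (A : Set D) (T : D × ℝ → D) : Prop where
  continuous : Continuous T
  zero : ∀ d, T (d, 0) = d
  proper : ∀ K : Set D, IsCompact K → ∃ K' : Set D, IsCompact K' ∧ ∃ R : ℝ,
    ∀ d ∈ A, ∀ r, 0 ≤ r → T (d, r) ∈ K → d ∈ K' ∧ r ≤ R

open Classical in
/-- The path along a semiflow, reparametrized to reach `∞` at time `1`. -/
noncomputable def flowPath (T : D × ℝ → D) (d : D) (s : ℝ) : OnePoint D :=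
  if s < 1 then (T (d, max s 0 / (1 - s)) : OnePoint D) else ∞

variable {A : Set D} {T : D × ℝ → D}

theorem flowPath_zero (hT : IsEscapingFlow A T) (d : D) : flowPath T d 0 = d := by
  simp [flowPath, hT.zero]

omit [TopologicalSpace D] in
theorem flowPath_of_one_le (d : D) {s : ℝ} (hs : 1 ≤ s) : flowPath T d s = ∞ :=
  if_neg hs.not_gt

/-- For `R ≥ 0`, the bound `s / (1 - s) ≤ R` amounts to `s ≤ 1 - 1 / (1 + R)`, whence the `ε`. The
alternative `s = 0` admits starting points outside `A`, which the homotopies below never move. -/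
theorem exists_isCompact_flowPath (hT : IsEscapingFlow A T) {K : Set D} (hK : IsCompact K) :
    ∃ K' : Set D, IsCompact K' ∧ ∃ ε : ℝ, 0 < ε ∧ ∀ d s, (d ∈ A ∨ s = 0) → ∀ x ∈ K,
      flowPath T d s = (x : OnePoint D) → d ∈ K' ∧ s ≤ 1 - ε := by
  obtain ⟨K', hK', R, h⟩ := hT.proper K hK
  refine ⟨K' ∪ K, hK'.union hK, 1 / (1 + |R|), by positivity, ?_⟩
  have hle : 1 / (1 + |R|) ≤ 1 := by
    rw [div_le_one (by positivity)]
    linarith [abs_nonneg R]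
  rintro d s hds x hx hs
  rcases eq_or_ne s 0 with rfl | hs0
  · rw [flowPath_zero hT, OnePoint.coe_eq_coe] at hs
    exact ⟨Or.inr (hs ▸ hx), by linarith⟩
  · have hd : d ∈ A := hds.resolve_right hs0
    by_cases h1 : s < 1
    · rw [flowPath, if_pos h1, OnePoint.coe_eq_coe] at hs
      have hpos : 0 < 1 - s := by linarith
      obtain ⟨hdK, hR⟩ := h d hd _ (by positivity) (hs ▸ hx)
      refine ⟨Or.inl hdK, ?_⟩
      rw [div_le_iff₀ hpos] at hR
      have h3 : s ≤ |R| * (1 - s) :=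
        (le_max_left _ _).trans (hR.trans (by gcongr; exact le_abs_self R))
      have h4 : 1 ≤ (1 - s) * (1 + |R|) := by linarith
      have := (div_le_iff₀ (by positivity : 0 < 1 + |R|)).2 h4
      linarith
    · rw [flowPath_of_one_le _ (not_lt.1 h1)] at hs
      exact absurd hs (OnePoint.infty_ne_coe _)

/-- Where the time is at least `1`, continuity is properness of the flow: nearby times exceed `1 -
ε`, so nearby values avoid `K`. -/
theorem continuous_flowPath {Y : Type*} [TopologicalSpace Y] (hT : IsEscapingFlow A T)
    {a : Y → D} {m : Y → ℝ} (ha : Continuous a) (hm : Continuous m)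
    (h : ∀ y, a y ∈ A ∨ m y = 0) : Continuous fun y => flowPath T (a y) (m y) := by
  rw [continuous_iff_continuousAt]
  intro y
  by_cases hy : m y < 1
  · have hev : ∀ᶠ y' in 𝓝 y, m y' < 1 := hm.continuousAt.eventually_lt_const hy
    have : ContinuousAt
        (fun y => (T (a y, max (m y) 0 / (1 - m y)) : OnePoint D)) y := by
      have h1 : 1 - m y ≠ 0 := by linarith
      have h2 : ContinuousAt (fun y => (a y, max (m y) 0 / (1 - m y))) y := by
        fun_prop (disch := assumption)
      exact (OnePoint.continuous_coe.comp hT.continuous).continuousAt.comp h2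
    refine this.congr ?_
    filter_upwards [hev] with y' hy'
    rw [flowPath, if_pos hy']
  · rw [ContinuousAt, flowPath_of_one_le _ (not_lt.1 hy),
      OnePoint.hasBasis_nhds_infty.tendsto_right_iff]
    rintro K ⟨-, hK⟩
    obtain ⟨K', -, ε, hε, hKε⟩ := exists_isCompact_flowPath hT hK
    have hev : ∀ᶠ y' in 𝓝 y, 1 - ε < m y' :=
      hm.continuousAt.eventually_const_lt (by linarith)
    filter_upwards [hev] with y' hy'
    rw [← OnePoint.compl_image_coe]
    rintro ⟨x, hx, hxy⟩
    have := (hKε _ _ (h y') x hx hxy.symm).2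
    linarith

end Flow

/-! ### The space (A × S) ∪ (D × 0). -/

section Detach

variable {D : Type*} [TopologicalSpace D]

/-- The union of `A × S` and `D × {0}`. -/
def glued (A : Set D) (S : Set ℂ) : Set (D × ℂ) := {p | p.2 ∈ S ∧ (p.2 = 0 ∨ p.1 ∈ A)}

/-- The complement of `D × {0}` in `glued A S`. -/
def detached (A : Set D) (S : Set ℂ) : Set (glued A S) := {x | x.1.2 ≠ 0}

/-- A closed cone with apex `0`. -/
structure IsClosedCone (S : Set ℂ) : Prop where
  isClosed : IsClosed S
  zero_mem : 0 ∈ S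
  smul_mem : ∀ c : ℝ, 0 ≤ c → ∀ w ∈ S, c • w ∈ S

theorem IsClosedCone.soft_mem {S : Set ℂ} (hS : IsClosedCone S) (h : ℝ) {w : ℂ} (hw : w ∈ S) :
    soft h w ∈ S := by
  obtain ⟨c, hc, e⟩ := exists_soft_eq_smul h w
  exact e ▸ hS.smul_mem c hc w hw

variable {A : Set D} {S : Set ℂ} {T : D × ℝ → D}

theorem isClosed_glued (hA : IsClosed A) (hS : IsClosed S) : IsClosed (glued A S) :=
  (hS.preimage continuous_snd).inter <|
    (isClosed_singleton.preimage continuous_snd).union (hA.preimage continuous_fst)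

theorem isOpen_detached : IsOpen (detached A S) :=
  isOpen_ne.preimage (continuous_snd.comp continuous_subtype_val)

/-- Radial contraction of the factor `S` by `h`. -/
noncomputable def shrink (hS : IsClosedCone S) (h : ℝ) (x : glued A S) : glued A S :=
  ⟨(x.1.1, soft h x.1.2), hS.soft_mem h x.2.1, x.2.2.imp (fun e => by simp [e, soft]) id⟩

theorem continuous_shrink (hS : IsClosedCone S) :
    Continuous fun p : ℝ × glued A S => shrink hS p.1 p.2 := by
  refine Continuous.subtype_mk (Continuous.prodMk (by fun_prop) ?_) _
  exact continuous_soft.comp (f := fun p : ℝ × glued A S => (p.1, p.2.1.2)) (by fun_prop)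

/-- The inclusion of `D` into `glued A S`. -/
def zeroSection (A : Set D) (hS : IsClosedCone S) (d : D) : glued A S :=
  ⟨(d, 0), hS.zero_mem, Or.inl rfl⟩

theorem isClosedEmbedding_zeroSection (A : Set D) (hS : IsClosedCone S) :
    IsClosedEmbedding (zeroSection A hS) := by
  refine .of_continuous_injective_isClosedMap ?_ ?_ ?_
  · exact Continuous.subtype_mk (by fun_prop) _
  · intro a b h
    exact congrArg (fun x => x.1.1) h
  · intro C hC
    have : zeroSection A hS '' C = {x | x.1.1 ∈ C ∧ x.1.2 = 0} := by
      ext x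
      constructor
      · rintro ⟨d, hd, rfl⟩
        exact ⟨hd, rfl⟩
      · rintro ⟨h1, h2⟩
        exact ⟨_, h1, Subtype.ext (Prod.ext rfl h2.symm)⟩
    rw [this]
    exact (hC.preimage (by fun_prop : Continuous fun x : glued A S => x.1.1)).inter
      (isClosed_singleton.preimage (by fun_prop : Continuous fun x : glued A S => x.1.2))

omit [TopologicalSpace D] in
theorem shrink_of_le (hS : IsClosedCone S) {h : ℝ} {x : glued A S} (hx : ‖x.1.2‖ ≤ h) :
    shrink hS h x = zeroSection A hS x.1.1 :=
  Subtype.ext (Prod.ext rfl (soft_eq_zero hx))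

omit [TopologicalSpace D] in
@[simp] theorem shrink_zero (hS : IsClosedCone S) (x : glued A S) : shrink hS 0 x = x :=
  Subtype.ext (Prod.ext rfl (soft_zero_left _))

omit [TopologicalSpace D] in
theorem shrink_shrink (hS : IsClosedCone S) {a b : ℝ} (ha : 0 ≤ a) (hb : 0 ≤ b)
    {x : glued A S} (h : a + b ≤ ‖x.1.2‖) :
    shrink hS a (shrink hS b x) = shrink hS (a + b) x :=
  Subtype.ext (Prod.ext rfl (soft_soft ha hb h))

theorem exists_of_onePointMap_eq {X Y : Type*} [TopologicalSpace X] [TopologicalSpace Y]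
    {j : X → Y} (hj : IsClosedEmbedding j) {p : OnePoint X} {y : Y}
    (h : onePointMap hj p = (y : OnePoint Y)) : ∃ x : X, p = x ∧ j x = y := by
  induction p using OnePoint.rec with
  | infty => exact absurd h (OnePoint.infty_ne_coe _)
  | coe x => exact ⟨x, rfl, OnePoint.coe_injective h⟩

theorem exists_of_collapse_eq {X : Type*} {U : Set X} {x : X} {y : U}
    (h : collapse U x = (y : OnePoint U)) : y.1 = x := by
  by_cases hx : x ∈ U
  · rw [collapse_of_mem hx, OnePoint.coe_eq_coe] at h
    rw [← h]
  · rw [collapse_of_notMem hx] at h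
    exact absurd h (OnePoint.infty_ne_coe _)

/-- The part of `glued A S` over `K` with `ε ≤ ‖w‖ ≤ R`. -/
def shell (A : Set D) (S : Set ℂ) (K : Set D) (ε R : ℝ) : Set (glued A S) :=
  {x | x.1.1 ∈ K ∧ ε ≤ ‖x.1.2‖ ∧ ‖x.1.2‖ ≤ R}

theorem isCompact_shell (hA : IsClosed A) (hS : IsClosed S) {K : Set D} (hK : IsCompact K)
    (ε R : ℝ) : IsCompact (shell A S K ε R) := by
  have h1 : IsCompact ((↑) ⁻¹' (K ×ˢ Metric.closedBall (0 : ℂ) R) : Set (glued A S)) :=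
    (isClosed_glued hA hS).isClosedEmbedding_subtypeVal.isCompact_preimage
      (hK.prod (isCompact_closedBall _ _))
  have h2 : IsClosed {x : glued A S | ε ≤ ‖x.1.2‖} := isClosed_le (by fun_prop) (by fun_prop)
  convert h1.inter_right h2 using 1
  ext x
  simp only [shell, mem_ofPred_eq, mem_inter_iff, mem_preimage, mem_prod, mem_closedBall_zero_iff]
  tauto

theorem isCompact_preimage_shell (hA : IsClosed A) (hS : IsClosed S) {K : Set D}
    (hK : IsCompact K) {ε : ℝ} (hε : 0 < ε) (R : ℝ) :
    IsCompact ((↑) ⁻¹' shell A S K ε R : Set (detached A S)) := by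
  rw [IsInducing.subtypeVal.isCompact_preimage_iff]
  · exact isCompact_shell hA hS hK ε R
  · rintro x ⟨-, hx, -⟩
    rw [Subtype.range_coe]
    exact norm_pos_iff.1 (hε.trans_le hx)

/-- The compact sets that control all the maps used in detaching `A × S` from `D`. -/
theorem exists_control (hT : IsEscapingFlow A T) (hS : IsClosedCone S) {KD : Set D}
    (hKD : IsCompact KD) {KX : Set (glued A S)} (hKX : IsCompact KX) :
    ∃ K : Set D, IsCompact K ∧ KD ⊆ K ∧ ∃ ε R : ℝ, 0 < ε ∧ 2 ≤ R ∧
      (∀ d s, (d ∈ A ∨ s = 0) → ∀ x ∈ KD, flowPath T d s = (x : OnePoint D) →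
        d ∈ K ∧ s ≤ 1 - ε) ∧
      ∀ x h, 0 ≤ h → h ≤ 2 → shrink hS h x ∈ KX → x.1.1 ∈ K ∧ ‖x.1.2‖ ≤ R := by
  obtain ⟨K', hK', ε, hε, h⟩ := exists_isCompact_flowPath hT hKD
  have hc : Continuous fun x : glued A S => ‖x.1.2‖ := by fun_prop
  obtain ⟨R, hR⟩ := (hKX.image hc).bddAbove
  have hf : Continuous fun x : glued A S => x.1.1 := by fun_prop
  refine ⟨K' ∪ KD ∪ (fun x : glued A S => x.1.1) '' KX,
    (hK'.union hKD).union (hKX.image hf), fun x hx => Or.inl (Or.inr hx), ε, |R| + 2, hε,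
    by linarith [abs_nonneg R], ?_, ?_⟩
  · intro d s hds x hx hs
    obtain ⟨h1, h2⟩ := h d s hds x hx hs
    exact ⟨Or.inl (Or.inl h1), h2⟩
  · intro x h h0 h2 hx
    refine ⟨Or.inr ⟨_, hx, rfl⟩, ?_⟩
    have h3 : ‖soft h x.1.2‖ ≤ R := hR ⟨_, hx, rfl⟩
    rcases le_total h ‖x.1.2‖ with h4 | h4
    · rw [norm_soft_of_le h0 h4] at h3
      linarith [le_abs_self R]
    · linarith [abs_nonneg R]

end Detach

end TorusComplement

namespace TorusComplement

open Set Filter Topology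
open scoped ContinuousMap OnePoint unitInterval

/-! ### Detaching A × S from D. -/

section Detach

variable {D : Type*} [TopologicalSpace D] {A : Set D} {S : Set ℂ} {T : D × ℝ → D}

theorem continuous_prod_sum {P X Y Z : Type*} [TopologicalSpace P] [TopologicalSpace X]
    [TopologicalSpace Y] [TopologicalSpace Z] {F : P × (X ⊕ Y) → Z}
    (hl : Continuous fun p : P × X => F (p.1, .inl p.2))
    (hr : Continuous fun p : P × Y => F (p.1, .inr p.2)) : Continuous F := by
  let e : P × (X ⊕ Y) ≃ₜ (P × X) ⊕ (P × Y) := Homeomorph.prodSumDistrib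
  have h : Continuous (F ∘ e.symm) := continuous_sum_dom.2 ⟨hl, hr⟩
  simpa [Function.comp_def] using h.comp e.continuous

/-- The detaching map: near `D × {0}` the factor `A` flows to infinity in `D`. -/
noncomputable def detachFun (hS : IsClosedCone S) (T : D × ℝ → D) (x : glued A S) :
    OnePoint (detached A S ⊕ D) :=
  if ‖x.1.2‖ ≤ 1 then onePointMap .inr (flowPath T x.1.1 ‖x.1.2‖)
  else onePointMap .inl (collapse (detached A S) (shrink hS 1 x))

/-- The homotopy inverse of the detaching map. -/
noncomputable def attachFun (hS : IsClosedCone S) (T : D × ℝ → D) :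
    detached A S ⊕ D → OnePoint (glued A S) :=
  Sum.elim
    (fun x => if ‖x.1.1.2‖ ≤ 1 then
        onePointMap (isClosedEmbedding_zeroSection A hS) (flowPath T x.1.1.1 (1 - ‖x.1.1.2‖))
      else (shrink hS 1 x.1 : OnePoint (glued A S)))
    fun d => (zeroSection A hS d : OnePoint (glued A S))

/-- The homotopy from the identity to `attachFun ∘ detachFun`. -/
noncomputable def gluedHomotopy (hS : IsClosedCone S) (T : D × ℝ → D) (p : I × glued A S) :
    OnePoint (glued A S) :=
  if ‖p.2.1.2‖ ≤ 2 * p.1 then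
    onePointMap (isClosedEmbedding_zeroSection A hS)
      (flowPath T p.2.1.1 (min ‖p.2.1.2‖ (2 * p.1 - ‖p.2.1.2‖)))
  else (shrink hS (2 * p.1) p.2 : OnePoint (glued A S))

/-- The homotopy from the identity to `detachFun ∘ attachFun`. -/
noncomputable def detachedHomotopy (hS : IsClosedCone S) (T : D × ℝ → D)
    (p : I × (detached A S ⊕ D)) : OnePoint (detached A S ⊕ D) :=
  Sum.elim
    (fun x => if ‖x.1.1.2‖ ≤ 2 * p.1 then
        onePointMap .inr
          (flowPath T x.1.1.1 (1 - min ‖x.1.1.2‖ (2 * p.1 - ‖x.1.1.2‖)))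
      else onePointMap .inl (collapse (detached A S) (shrink hS (2 * p.1) x.1)))
    (fun d => ((.inr d : detached A S ⊕ D) : OnePoint (detached A S ⊕ D))) p.2

omit [TopologicalSpace D] in
theorem mem_or_norm_eq_zero (x : glued A S) : x.1.1 ∈ A ∨ ‖x.1.2‖ = 0 :=
  x.2.2.symm.imp id fun h => by rw [h, norm_zero]

omit [TopologicalSpace D] in
theorem fst_mem_of_detached (x : detached A S) : x.1.1.1 ∈ A := x.1.2.2.resolve_left x.2

omit [TopologicalSpace D] in
theorem mem_or_min_eq_zero (x : glued A S) (t : I) :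
    x.1.1 ∈ A ∨ min ‖x.1.2‖ (2 * (t : ℝ) - ‖x.1.2‖) = 0 :=
  (mem_or_norm_eq_zero x).imp id fun h => by
    rw [h, sub_zero, min_eq_left (mul_nonneg two_pos.le t.2.1)]

omit [TopologicalSpace D] in
theorem zeroSection_notMem_detached (hS : IsClosedCone S) (d : D) :
    zeroSection A hS d ∉ detached A S := fun h => h rfl

omit [TopologicalSpace D] in
theorem collapse_shrink_of_le (hS : IsClosedCone S) {h : ℝ} {x : glued A S}
    (hx : ‖x.1.2‖ ≤ h) : collapse (detached A S) (shrink hS h x) = ∞ := by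
  rw [shrink_of_le hS hx, collapse_of_notMem (zeroSection_notMem_detached hS _)]

variable [T2Space D]

/-- At `‖w‖ = 1` both branches equal `∞`: the flow has arrived there, and the contraction lands on
the zero section, which is collapsed. -/
theorem continuous_detachFun (hS : IsClosedCone S) (hT : IsEscapingFlow A T) :
    Continuous (detachFun (A := A) hS T) := by
  have h1 : Continuous fun x : glued A S => flowPath T x.1.1 ‖x.1.2‖ :=
    continuous_flowPath hT (by fun_prop) (by fun_prop) mem_or_norm_eq_zero
  have h2 := (continuous_collapse (isOpen_detached (A := A) (S := S))).comp
    ((continuous_shrink hS).comp (f := fun x => (1, x)) (by fun_prop))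
  refine Continuous.if_le ((map_continuous _).comp h1) ((map_continuous _).comp h2)
    (by fun_prop) (by fun_prop) fun x hx => ?_
  have h3 := collapse_shrink_of_le hS hx.le
  simp [flowPath_of_one_le _ hx.ge, h3]

-- At `‖w‖ = 1` both branches give the point of the zero section below `x`: the flow has time `0`
-- and the contraction reaches the apex.
omit [T2Space D] in
theorem continuous_attachFun (hS : IsClosedCone S) (hT : IsEscapingFlow A T) :
    Continuous (attachFun (A := A) hS T) := by
  refine continuous_sum_dom.2 ⟨?_, ?_⟩
  · have h1 : Continuous fun x : detached A S => flowPath T x.1.1.1 (1 - ‖x.1.1.2‖) :=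
      continuous_flowPath hT (by fun_prop) (by fun_prop) fun x => Or.inl (fst_mem_of_detached x)
    have h2 := (continuous_shrink hS).comp (f := fun x : detached A S => (1, x.1)) (by fun_prop)
    refine Continuous.if_le ((map_continuous _).comp h1) (OnePoint.continuous_coe.comp h2)
      (by fun_prop) (by fun_prop) fun x hx => ?_
    simp [hx, flowPath_zero hT, shrink_of_le hS hx.le]
  · exact OnePoint.continuous_coe.comp (isClosedEmbedding_zeroSection A hS).continuous

omit [T2Space D] in
theorem continuous_gluedHomotopy (hS : IsClosedCone S) (hT : IsEscapingFlow A T) :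
    Continuous (gluedHomotopy (A := A) hS T) := by
  have h1 : Continuous fun p : I × glued A S =>
      flowPath T p.2.1.1 (min ‖p.2.1.2‖ (2 * (p.1 : ℝ) - ‖p.2.1.2‖)) :=
    continuous_flowPath hT (by fun_prop) (by fun_prop) fun p => mem_or_min_eq_zero p.2 p.1
  have h2 := (continuous_shrink hS).comp
    (f := fun p : I × glued A S => (2 * (p.1 : ℝ), p.2)) (by fun_prop)
  refine Continuous.if_le ((map_continuous _).comp h1) (OnePoint.continuous_coe.comp h2)
    (by fun_prop) (by fun_prop) fun p hp => ?_
  simp [← hp, flowPath_zero hT, shrink_of_le hS le_rfl]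

theorem continuous_detachedHomotopy (hS : IsClosedCone S) (hT : IsEscapingFlow A T) :
    Continuous (detachedHomotopy (A := A) hS T) := by
  refine continuous_prod_sum ?_ ?_
  · have h1 : Continuous fun p : I × detached A S =>
        flowPath T p.2.1.1.1 (1 - min ‖p.2.1.1.2‖ (2 * (p.1 : ℝ) - ‖p.2.1.1.2‖)) :=
      continuous_flowPath hT (by fun_prop) (by fun_prop) fun p =>
        Or.inl (fst_mem_of_detached p.2)
    have h2 := (continuous_collapse (isOpen_detached (A := A) (S := S))).comp
      ((continuous_shrink hS).comp
        (f := fun p : I × detached A S => (2 * (p.1 : ℝ), p.2.1)) (by fun_prop))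
    refine Continuous.if_le ((map_continuous _).comp h1) ((map_continuous _).comp h2)
      (by fun_prop) (by fun_prop) fun p hp => ?_
    have h3 := collapse_shrink_of_le hS hp.le
    simp [← hp, flowPath_of_one_le] at h3 ⊢
    simp [h3]
  · exact OnePoint.continuous_coe.comp (by fun_prop)

omit [T2Space D] in
theorem isCompact_image_inl {K : Set (detached A S ⊕ D)} (hK : IsCompact K) :
    IsCompact ((fun x : detached A S => x.1) '' (Sum.inl ⁻¹' K)) :=
  (IsClosedEmbedding.inl.isCompact_preimage hK).image continuous_subtype_val

omit [T2Space D] in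
theorem properFamily_detachFun (hA : IsClosed A) (hS : IsClosedCone S)
    (hT : IsEscapingFlow A T) :
    ProperFamily fun p : Unit × glued A S => detachFun hS T p.2 := by
  intro K hK
  obtain ⟨K', hK', -, ε, R, hε, hR, h1, h2⟩ := exists_control hT hS
    (IsClosedEmbedding.inr.isCompact_preimage hK) (isCompact_image_inl hK)
  refine ⟨_, isCompact_shell hA hS.isClosed hK' 0 R, ?_⟩
  rintro _ x w hw hx
  dsimp only [detachFun] at hx
  split_ifs at hx with hx1
  · obtain ⟨d, hd, rfl⟩ := exists_of_onePointMap_eq _ hx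
    exact ⟨(h1 _ _ (mem_or_norm_eq_zero x) d hw hd).1, norm_nonneg _, by linarith⟩
  · obtain ⟨y, hy, rfl⟩ := exists_of_onePointMap_eq _ hx
    obtain ⟨h3, h4⟩ := h2 x 1 one_pos.le one_le_two ⟨y, hw, exists_of_collapse_eq hy⟩
    exact ⟨h3, norm_nonneg _, h4⟩

omit [T2Space D] in
theorem properFamily_attachFun (hA : IsClosed A) (hS : IsClosedCone S)
    (hT : IsEscapingFlow A T) :
    ProperFamily fun p : Unit × (detached A S ⊕ D) => attachFun hS T p.2 := by
  intro K hK
  have hKD := (isClosedEmbedding_zeroSection A hS).isCompact_preimage hK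
  obtain ⟨K', hK', -, ε, R, hε, hR, h1, h2⟩ := exists_control hT hS hKD hK
  refine ⟨_, ((isCompact_preimage_shell hA hS.isClosed hK'
    (lt_min hε one_pos) R).image continuous_inl).union (hKD.image continuous_inr), ?_⟩
  rintro _ (x | d) w hw hx
  · refine Or.inl ⟨x, ?_, rfl⟩
    dsimp only [attachFun, Sum.elim_inl] at hx
    split_ifs at hx with hx1
    · obtain ⟨d, hd, rfl⟩ := exists_of_onePointMap_eq _ hx
      obtain ⟨h3, h4⟩ := h1 _ _ (Or.inl (fst_mem_of_detached x)) d hw hd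
      exact ⟨h3, (min_le_left _ _).trans (by linarith), by linarith⟩
    · rw [OnePoint.coe_eq_coe] at hx
      obtain ⟨h3, h4⟩ := h2 x.1 1 one_pos.le one_le_two (hx ▸ hw)
      exact ⟨h3, (min_le_right _ _).trans (by linarith), h4⟩
  · refine Or.inr ⟨d, ?_, rfl⟩
    have : zeroSection A hS d = w := OnePoint.coe_injective hx
    rwa [mem_preimage, this]

omit [T2Space D] in
theorem properFamily_gluedHomotopy (hA : IsClosed A) (hS : IsClosedCone S)
    (hT : IsEscapingFlow A T) : ProperFamily (gluedHomotopy (A := A) hS T) := by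
  intro K hK
  obtain ⟨K', hK', -, ε, R, hε, hR, h1, h2⟩ := exists_control hT hS
    ((isClosedEmbedding_zeroSection A hS).isCompact_preimage hK) hK
  refine ⟨_, isCompact_shell hA hS.isClosed hK' 0 R, ?_⟩
  intro t x w hw hx
  have ht := t.2.2
  have ht0 := t.2.1
  dsimp only [gluedHomotopy] at hx
  split_ifs at hx with hx1
  · obtain ⟨d, hd, rfl⟩ := exists_of_onePointMap_eq _ hx
    exact ⟨(h1 _ _ (mem_or_min_eq_zero x t) d hw hd).1, norm_nonneg _, by linarith⟩
  · rw [OnePoint.coe_eq_coe] at hx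
    obtain ⟨h3, h4⟩ := h2 x _ (by linarith) (by linarith) (hx ▸ hw)
    exact ⟨h3, norm_nonneg _, h4⟩

omit [T2Space D] in
theorem properFamily_detachedHomotopy (hA : IsClosed A) (hS : IsClosedCone S)
    (hT : IsEscapingFlow A T) : ProperFamily (detachedHomotopy (A := A) hS T) := by
  intro K hK
  have hKD := IsClosedEmbedding.inr.isCompact_preimage hK
  have hKX := isCompact_image_inl hK
  obtain ⟨K', hK', -, ε, R, hε, hR, h1, h2⟩ := exists_control hT hS hKD hKX
  -- Compact sets of the detached part must also stay away from `w = 0`. In the flow branch this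
  -- comes from `ε`; in the contraction branch from the minimum `ε'` of the norm on the compact
  -- target, as contraction only decreases norms.
  obtain ⟨ε', hε', h5⟩ := hKX.exists_forall_le' (f := fun x => ‖x.1.2‖) (a := 0)
    (by fun_prop) (by rintro _ ⟨x, -, rfl⟩; exact norm_pos_iff.2 x.2)
  refine ⟨_, ((isCompact_preimage_shell hA hS.isClosed hK'
    (lt_min hε hε') R).image continuous_inl).union (hKD.image continuous_inr), ?_⟩
  rintro t (x | d) w hw hx
  · refine Or.inl ⟨x, ?_, rfl⟩
    have ht := t.2.2
    have ht0 := t.2.1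
    dsimp only [detachedHomotopy, Sum.elim_inl] at hx
    split_ifs at hx with hx1
    · obtain ⟨d, hd, rfl⟩ := exists_of_onePointMap_eq _ hx
      obtain ⟨h3, h4⟩ := h1 _ _ (Or.inl (fst_mem_of_detached x)) d hw hd
      have h6 := min_le_left ‖x.1.1.2‖ (2 * (t : ℝ) - ‖x.1.1.2‖)
      exact ⟨h3, (min_le_left _ _).trans (by linarith), by linarith⟩
    · obtain ⟨y, hy, rfl⟩ := exists_of_onePointMap_eq _ hx
      have hy' := exists_of_collapse_eq hy
      obtain ⟨h3, h4⟩ := h2 x.1 _ (by linarith) (by linarith) ⟨y, hw, hy'⟩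
      refine ⟨h3, (min_le_right _ _).trans ?_, h4⟩
      have h6 := h5 _ ⟨y, hw, rfl⟩
      dsimp only at h6
      rw [hy'] at h6
      exact h6.trans (norm_soft_le _ _)
  · refine Or.inr ⟨d, ?_, rfl⟩
    have : Sum.inr d = w := OnePoint.coe_injective hx
    rwa [mem_preimage, this]

omit [TopologicalSpace D] [T2Space D] in
theorem norm_shrink (hS : IsClosedCone S) {h : ℝ} {x : glued A S} (h0 : 0 ≤ h)
    (hx : h ≤ ‖x.1.2‖) : ‖(shrink hS h x).1.2‖ = ‖x.1.2‖ - h :=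
  norm_soft_of_le h0 hx

/-- If `A` can be moved to infinity inside `D`, then `A × S` can be detached from `D`. -/
theorem ProperEquiv.detach (hA : IsClosed A) (hS : IsClosedCone S) (hT : IsEscapingFlow A T) :
    ProperEquiv (glued A S) (detached A S ⊕ D) := by
  obtain ⟨f, hf, hf'⟩ := exists_continuousMap_onePoint (continuous_detachFun hS hT)
    (properFamily_detachFun hA hS hT)
  obtain ⟨g, hg, hg'⟩ := exists_continuousMap_onePoint (continuous_attachFun hS hT)
    (properFamily_attachFun hA hS hT)
  have hg_inr : ∀ p, g (onePointMap .inr p) =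
      onePointMap (isClosedEmbedding_zeroSection A hS) p := by
    intro p
    induction p using OnePoint.rec with
    | infty => exact hg
    | coe d => exact hg' _
  have hf_zero : ∀ p, f (onePointMap (isClosedEmbedding_zeroSection A hS) p) =
      onePointMap .inr p := by
    intro p
    induction p using OnePoint.rec with
    | infty => exact hf
    | coe d =>
      rw [onePointMap_coe, hf']
      simp [detachFun, zeroSection, flowPath_zero hT]
  have hmem : ∀ x : glued A S, 1 < ‖x.1.2‖ → shrink hS 1 x ∈ detached A S := fun x hx =>
    norm_pos_iff.1 (by rw [norm_shrink hS one_pos.le hx.le]; linarith)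
  refine ⟨f, g, hf, hg, .symm ?_, .symm ?_⟩
  · refine homotopicRel_of_properFamily rfl (by simp [hf, hg])
      (continuous_gluedHomotopy hS hT) (properFamily_gluedHomotopy hA hS hT) ?_ ?_
    · intro x
      by_cases hx : ‖x.1.2‖ ≤ 0
      · have h0 : ‖x.1.2‖ = 0 := le_antisymm hx (norm_nonneg _)
        have : zeroSection A hS x.1.1 = x := by
          rw [← shrink_of_le hS hx, shrink_zero]
        simp [gluedHomotopy, h0, flowPath_zero hT, this]
      · simp only [gluedHomotopy, Icc.coe_zero, mul_zero]
        rw [if_neg hx, shrink_zero]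
        rfl
    · intro x
      simp only [gluedHomotopy, Icc.coe_one, mul_one, ContinuousMap.comp_apply, hf', detachFun]
      by_cases h1 : ‖x.1.2‖ ≤ 1
      · rw [if_pos h1, if_pos (by linarith), hg_inr, min_eq_left (by linarith)]
      · rw [if_neg h1, collapse_of_mem (hmem x (not_le.1 h1)), onePointMap_coe, hg']
        have h3 := norm_shrink hS one_pos.le (not_le.1 h1).le
        dsimp only [attachFun, Sum.elim_inl]
        by_cases h2 : ‖x.1.2‖ ≤ 2
        · rw [if_pos h2, h3, if_pos (by linarith), min_eq_right (by linarith)]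
          congr 2
          ring
        · rw [if_neg h2, h3, if_neg (by linarith), shrink_shrink hS one_pos.le one_pos.le
            (by linarith), one_add_one_eq_two]
  · refine homotopicRel_of_properFamily rfl (by simp [hf, hg])
      (continuous_detachedHomotopy hS hT) (properFamily_detachedHomotopy hA hS hT) ?_ ?_
    · rintro (x | d)
      · have hx : ¬ ‖x.1.1.2‖ ≤ 0 := not_le.2 (norm_pos_iff.2 x.2)
        simp only [detachedHomotopy, Icc.coe_zero, mul_zero, Sum.elim_inl]
        rw [if_neg hx, shrink_zero, collapse_of_mem x.2]
        rfl
      · rfl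
    · rintro (x | d)
      -- In this order the flow time is `1` minus the tent: as `‖w‖` runs from `0` to `2` the value
      -- comes in from `∞` and returns to it.
      · simp only [detachedHomotopy, Icc.coe_one, mul_one, ContinuousMap.comp_apply, hg',
          attachFun, Sum.elim_inl]
        by_cases h1 : ‖x.1.1.2‖ ≤ 1
        · rw [if_pos h1, if_pos (by linarith), hf_zero, min_eq_left (by linarith)]
        · rw [if_neg h1, hf', detachFun]
          have h3 := norm_shrink hS one_pos.le (not_le.1 h1).le
          by_cases h2 : ‖x.1.1.2‖ ≤ 2
          · rw [if_pos h2, h3, if_pos (by linarith), min_eq_right (by linarith)]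
            congr 2
            ring
          · rw [if_neg h2, h3, if_neg (by linarith), shrink_shrink hS one_pos.le one_pos.le
              (by linarith), one_add_one_eq_two]
      · simp only [ContinuousMap.comp_apply, hg', attachFun, Sum.elim_inr, hf']
        simp [detachedHomotopy, detachFun, zeroSection, flowPath_zero hT]

end Detach

end TorusComplement

namespace TorusComplement

open Set Filter Topology
open scoped ContinuousMap OnePoint unitInterval

/-! ### Splitting B × ℂˣ. -/

section Split

variable {D B : Type*} [TopologicalSpace D] [TopologicalSpace B]

/-- A closed cone without its apex. -/
def puncture (S : Set ℂ) : Set ℂ := {w | w ∈ S ∧ w ≠ 0}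

theorem locallyCompactSpace_puncture {S : Set ℂ} (hS : IsClosedCone S) :
    LocallyCompactSpace (puncture S) :=
  (hS.isClosed.isLocallyClosed.inter isOpen_ne.isLocallyClosed).locallyCompactSpace

/-- The detached part of `glued A S` is a product. -/
def detachedHomeomorph (A : Set D) (S : Set ℂ) : detached A S ≃ₜ A × puncture S where
  toFun x := (⟨x.1.1.1, fst_mem_of_detached x⟩, ⟨x.1.1.2, x.1.2.1, x.2⟩)
  invFun p := ⟨⟨(p.1, p.2), p.2.2.1, Or.inr p.1.2⟩, p.2.2.2⟩
  left_inv _ := rfl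
  right_inv _ := rfl
  continuous_toFun := by fun_prop
  continuous_invFun := by fun_prop

theorem ProperEquiv.empty_of_flow [T2Space D] {T : D × ℝ → D}
    (hT : IsEscapingFlow Set.univ T) : ProperEquiv D Empty := by
  refine ProperEquiv.empty (F := fun p => flowPath T p.2 (1 - p.1)) ?_ ?_ ?_ ?_
  · exact continuous_flowPath hT (by fun_prop) (by fun_prop) fun _ => Or.inl trivial
  · intro K hK
    obtain ⟨K', hK', ε, -, h⟩ := exists_isCompact_flowPath hT hK
    exact ⟨K', hK', fun t z w hw hz => (h _ _ (Or.inl trivial) w hw hz).1⟩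
  · exact fun z => flowPath_of_one_le _ (by simp)
  · intro z
    simp [flowPath_zero hT]

/-- The translation flow on `B × Q`. -/
def translate {Q : Set ℂ} (hQ : ∀ q ∈ Q, ∀ r : ℝ, 0 ≤ r → q + r ∈ Q) (p : (B × Q) × ℝ) : B × Q :=
  (p.1.1, ⟨p.1.2 + (max p.2 0 : ℝ), hQ _ p.1.2.2 _ (le_max_right _ _)⟩)

/-- By `hA` the norm grows by at least `r`, so landing in `K` bounds both the starting point and the
time. The condition holds on the zero section for any `Q`, and everywhere for the ray. -/
theorem isEscapingFlow_translate {Q : Set ℂ} (hQ : ∀ q ∈ Q, ∀ r : ℝ, 0 ≤ r → q + r ∈ Q)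
    (hQc : IsClosed Q) {A : Set (B × Q)}
    (hA : ∀ d ∈ A, ∀ r : ℝ, 0 ≤ r → ‖(d.2 : ℂ)‖ + r ≤ ‖(d.2 : ℂ) + r‖) :
    IsEscapingFlow A (translate (B := B) hQ) where
  continuous := by
    unfold translate
    fun_prop
  zero d := by
    simp [translate]
  proper K hK := by
    have hc : Continuous fun x : B × Q => ‖(x.2 : ℂ)‖ := by fun_prop
    obtain ⟨R, hR⟩ := (hK.image hc).bddAbove
    refine ⟨(Prod.fst '' K) ×ˢ (Subtype.val ⁻¹' Metric.closedBall 0 R),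
      (hK.image continuous_fst).prod
        (hQc.isClosedEmbedding_subtypeVal.isCompact_preimage (isCompact_closedBall _ _)), R, ?_⟩
    intro d hd r hr h
    have h1 : ‖(d.2 : ℂ) + (max r 0 : ℝ)‖ ≤ R := hR ⟨_, h, rfl⟩
    rw [max_eq_left hr] at h1
    have h2 := hA d hd r hr
    refine ⟨⟨⟨_, h, rfl⟩, ?_⟩, by linarith [norm_nonneg (d.2 : ℂ)]⟩
    rw [mem_preimage, mem_closedBall_zero_iff]
    linarith

/-- The zero section of `B × Q`. -/
def axis (B : Type*) (Q : Set ℂ) : Set (B × Q) := {d | (d.2 : ℂ) = 0}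

theorem isClosed_axis (Q : Set ℂ) : IsClosed (axis B Q) :=
  isClosed_singleton.preimage (by fun_prop : Continuous fun d : B × Q => (d.2 : ℂ))

/-- The zero section of `B × Q` is homeomorphic to `B`. -/
def axisHomeomorph {Q : Set ℂ} (hQ : 0 ∈ Q) : axis B Q ≃ₜ B where
  toFun x := x.1.1
  invFun b := ⟨(b, ⟨0, hQ⟩), rfl⟩
  left_inv x := Subtype.ext (Prod.ext rfl (Subtype.ext (Eq.symm x.2)))
  right_inv _ := rfl
  continuous_toFun := by fun_prop
  continuous_invFun := by fun_prop

/-- Interchanging the two cones in `B × (Q ∨ S)`. -/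
def gluedAxisHomeomorph (B : Type*) [TopologicalSpace B] (Q S : Set ℂ) :
    glued (axis B Q) S ≃ₜ glued (axis B S) Q where
  toFun x := ⟨((x.1.1.1, ⟨x.1.2, x.2.1⟩), x.1.1.2), x.1.1.2.2, x.2.2.symm⟩
  invFun x := ⟨((x.1.1.1, ⟨x.1.2, x.2.1⟩), x.1.1.2), x.1.1.2.2, x.2.2.symm⟩
  left_inv _ := rfl
  right_inv _ := rfl
  continuous_toFun := by fun_prop
  continuous_invFun := by fun_prop

variable [T2Space B] [LocallyCompactSpace B]

-- The zero section escapes along `Q` by translation, so the cone `S` can be cut off at its apex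
-- while `Q` stays whole.
omit [LocallyCompactSpace B] in
theorem ProperEquiv.glued_axis {Q S : Set ℂ} (hQ : IsClosedCone Q) (hS : IsClosedCone S)
    (hQ' : ∀ q ∈ Q, ∀ r : ℝ, 0 ≤ r → q + r ∈ Q) :
    ProperEquiv (glued (axis B Q) S) (B × puncture S ⊕ B × Q) := by
  refine (ProperEquiv.detach (isClosed_axis Q) hS
    (isEscapingFlow_translate hQ' hQ.isClosed ?_)).trans (.of_homeomorph ?_)
  · intro d hd r hr
    have hd' : (d.2 : ℂ) = 0 := hd
    simp [hd', abs_of_nonneg hr]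
  · exact ((detachedHomeomorph _ _).trans
      ((axisHomeomorph hQ.zero_mem).prodCongr (.refl _))).sumCongr (.refl _)

/-- The nonnegative real axis in `ℂ`. -/
def ray : Set ℂ := {w | w.im = 0 ∧ 0 ≤ w.re}

theorem isClosedCone_ray : IsClosedCone ray where
  isClosed := (isClosed_singleton.preimage Complex.continuous_im).inter
    (isClosed_Ici.preimage Complex.continuous_re)
  zero_mem := by simp [ray]
  smul_mem c hc w hw := ⟨by simp [hw.1], by simpa using mul_nonneg hc hw.2⟩

theorem isClosedCone_univ : IsClosedCone Set.univ where
  isClosed := isClosed_univ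
  zero_mem := trivial
  smul_mem _ _ _ _ := trivial

theorem norm_of_mem_ray {w : ℂ} (hw : w ∈ ray) : ‖w‖ = w.re := by
  rw [← Complex.abs_re_eq_norm.2 hw.1, abs_of_nonneg hw.2]

/-- The open ray is homeomorphic to `ℝ`. -/
noncomputable def punctureRayHomeomorph : puncture ray ≃ₜ ℝ where
  toFun w := Real.log (w : ℂ).re
  invFun x := ⟨(Real.exp x : ℝ), ⟨Complex.ofReal_im _, (Real.exp_pos x).le⟩, by
    exact_mod_cast (Real.exp_pos x).ne'⟩
  left_inv w := by
    have h : 0 < (w : ℂ).re := by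
      rw [← norm_of_mem_ray w.2.1]
      exact norm_pos_iff.2 w.2.2
    refine Subtype.ext (Complex.ext ?_ ?_)
    · simp only [Complex.ofReal_re]
      exact Real.exp_log h
    · simp only [Complex.ofReal_im]
      exact w.2.1.1.symm
  right_inv x := by simp only [Complex.ofReal_re, Real.log_exp]
  continuous_toFun := by
    refine Continuous.log (by fun_prop) fun w => ?_
    rw [← norm_of_mem_ray w.2.1]
    exact norm_ne_zero_iff.2 w.2.2
  continuous_invFun := by fun_prop

omit [LocallyCompactSpace B] in
theorem ProperEquiv.prod_ray_empty : ProperEquiv (B × ray) Empty := by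
  have hQ : ∀ q ∈ ray, ∀ r : ℝ, 0 ≤ r → q + r ∈ ray := fun q hq r hr =>
    ⟨by simp [hq.1], by simpa using add_nonneg hq.2 hr⟩
  refine .empty_of_flow (isEscapingFlow_translate hQ isClosedCone_ray.isClosed ?_)
  intro d _ r hr
  rw [norm_of_mem_ray d.2.2, norm_of_mem_ray (hQ _ d.2.2 r hr)]
  simp

/-- `B × ℂˣ` splits as the disjoint union of `B × ℝ` and `B × ℂ`. -/
theorem ProperEquiv.prod_puncture :
    ProperEquiv (B × puncture Set.univ) (B × ℝ ⊕ B × ℂ) := by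
  have := locallyCompactSpace_puncture isClosedCone_univ
  have : LocallyCompactSpace ray := isClosedCone_ray.isClosed.locallyCompactSpace
  have hQ : ∀ q ∈ ray, ∀ r : ℝ, 0 ≤ r → q + r ∈ ray := fun q hq r hr =>
    ⟨by simp [hq.1], by simpa using add_nonneg hq.2 hr⟩
  -- Adding `B × ray` changes nothing up to `ProperEquiv`, and produces exactly what is left of `B ×
  -- (ray ∨ ℂ)` after cutting off ℂ. Cutting off the ray instead leaves `B × ℝ` and `B × ℂ`.
  have h1 : ProperEquiv (B × puncture Set.univ) (B × puncture Set.univ ⊕ B × ray) :=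
    (ProperEquiv.of_homeomorph (Homeomorph.sumEmpty _ Empty).symm).trans
      ((ProperEquiv.refl _).sum ProperEquiv.prod_ray_empty.symm)
  refine h1.trans <| (ProperEquiv.glued_axis isClosedCone_ray isClosedCone_univ hQ).symm.trans <|
    (ProperEquiv.of_homeomorph (gluedAxisHomeomorph B _ _)).trans <|
    (ProperEquiv.glued_axis isClosedCone_univ isClosedCone_ray fun _ _ _ _ => trivial).trans <|
    .of_homeomorph ?_
  exact ((Homeomorph.refl B).prodCongr punctureRayHomeomorph).sumCongr
    ((Homeomorph.refl B).prodCongr (Homeomorph.Set.univ ℂ))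

end Split

/-! ### Recursion for the coordinate hyperplanes. -/

section Induction

/-- The union of the coordinate hyperplanes of `ℂᵗ`. -/
def coordHyperplanes (t : ℕ) : Set (Fin t → ℂ) := {z | ∃ j, z j = 0}

theorem isClosed_coordHyperplanes (t : ℕ) : IsClosed (coordHyperplanes t) := by
  have : coordHyperplanes t = ⋃ j, {z | z j = 0} := by
    ext; simp [coordHyperplanes]
  rw [this]
  exact isClosed_iUnion_of_finite fun j => isClosed_eq (by fun_prop) (by fun_prop)

variable {V : Type*} [TopologicalSpace V]

/-- The product of the coordinate hyperplanes with `V`, as a subset. -/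
def hyperplanesProd (t : ℕ) (V : Type*) : Set ((Fin t → ℂ) × V) :=
  {d | d.1 ∈ coordHyperplanes t}

/-- Separating off one coordinate from the coordinate hyperplanes. -/
def coordHyperplanesHomeomorph (t : ℕ) (V : Type*) [TopologicalSpace V] :
    coordHyperplanes (t + 1) × V ≃ₜ glued (hyperplanesProd t V) Set.univ where
  toFun p := ⟨((fun j => p.1.1 j.succ, p.2), p.1.1 0), trivial, by
    obtain ⟨j, hj⟩ := p.1.2
    induction j using Fin.cases with
    | zero => exact Or.inl hj
    | succ j => exact Or.inr ⟨j, hj⟩⟩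
  invFun x := (⟨Fin.cons x.1.2 x.1.1.1, by
    obtain h | ⟨j, hj⟩ := x.2.2
    · exact ⟨0, h⟩
    · exact ⟨j.succ, hj⟩⟩, x.1.1.2)
  left_inv p := by
    refine Prod.ext (Subtype.ext ?_) rfl
    exact Fin.cons_self_tail p.1.1
  right_inv _ := rfl
  continuous_toFun := by
    have h : Continuous fun p : coordHyperplanes (t + 1) × V => (p.1 : Fin (t + 1) → ℂ) := by
      fun_prop
    exact Continuous.subtype_mk (((continuous_pi fun j : Fin t => (continuous_apply j.succ).comp h).prodMk
      continuous_snd).prodMk ((continuous_apply 0).comp h)) _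
  continuous_invFun := by
    refine Continuous.prodMk (Continuous.subtype_mk (continuous_pi fun j => ?_) _) (by fun_prop)
    induction j using Fin.cases with
    | zero => simpa using (by fun_prop)
    | succ j => simpa using (by fun_prop)

/-- The two descriptions of the product of the coordinate hyperplanes with `V`. -/
def hyperplanesProdHomeomorph (t : ℕ) (V : Type*) [TopologicalSpace V] :
    hyperplanesProd t V ≃ₜ coordHyperplanes t × V where
  toFun x := (⟨x.1.1, x.2⟩, x.1.2)
  invFun p := ⟨(p.1, p.2), p.1.2⟩
  left_inv _ := rfl
  right_inv _ := rfl
  continuous_toFun := by fun_prop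
  continuous_invFun := by fun_prop

/-- If `z j = 0`, the `j`-th coordinate after time `r` is `r` itself, so a bound `R` on the image
forces `r ≤ R`, and then every `‖z i‖ ≤ 2 * R`. -/
theorem isEscapingFlow_diagonal (t : ℕ) : IsEscapingFlow (hyperplanesProd t V)
    fun p : ((Fin t → ℂ) × V) × ℝ => (fun j => p.1.1 j + p.2, p.1.2) where
  continuous := by fun_prop
  zero d := by simp
  proper K hK := by
    have hc : Continuous fun x : (Fin t → ℂ) × V => ‖x.1‖ := by fun_prop
    obtain ⟨R, hR⟩ := (hK.image hc).bddAbove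
    refine ⟨Metric.closedBall 0 (2 * R) ×ˢ (Prod.snd '' K),
      (isCompact_closedBall _ _).prod (hK.image continuous_snd), R, ?_⟩
    rintro ⟨z, v⟩ ⟨j, hj⟩ r hr h
    have h1 : ‖fun j => z j + (r : ℂ)‖ ≤ R := hR ⟨_, h, rfl⟩
    have h2 : r ≤ R := by
      have := (norm_le_pi_norm _ j).trans h1
      simpa [show z j = 0 from hj, abs_of_nonneg hr] using this
    refine ⟨⟨?_, ⟨_, h, rfl⟩⟩, h2⟩
    rw [mem_closedBall_zero_iff, pi_norm_le_iff_of_nonneg (by linarith)]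
    intro i
    have h3 : ‖z i + r‖ ≤ R := (norm_le_pi_norm (fun j => z j + (r : ℂ)) i).trans h1
    have h4 : ‖z i‖ ≤ ‖z i + r‖ + ‖(r : ℂ)‖ := by
      simpa using norm_sub_le (z i + r) (r : ℂ)
    rw [Complex.norm_real, Real.norm_of_nonneg hr] at h4
    dsimp only
    linarith

/-- A point with a vanishing coordinate has either first coordinate zero and the rest free, or the
rest in the smaller arrangement. Detaching separates the two cases, and `ProperEquiv.prod_puncture`
splits the resulting factor ℂˣ. -/
theorem ProperEquiv.coordHyperplanes_succ (t : ℕ) (V : Type*) [TopologicalSpace V] [T2Space V]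
    [LocallyCompactSpace V] :
    ProperEquiv (coordHyperplanes (t + 1) × V)
      (((coordHyperplanes t × (V × ℝ)) ⊕ (coordHyperplanes t × (V × ℂ))) ⊕
        ((Fin t → ℂ) × V)) := by
  have := (isClosed_coordHyperplanes t).locallyCompactSpace
  have := locallyCompactSpace_puncture isClosedCone_univ
  have hA : IsClosed (hyperplanesProd t V) := (isClosed_coordHyperplanes t).preimage continuous_fst
  have : LocallyCompactSpace (hyperplanesProd t V) := hA.locallyCompactSpace
  let e := (detachedHomeomorph (hyperplanesProd t V) Set.univ).trans
    ((hyperplanesProdHomeomorph t V).prodCongr (.refl _))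
  have h1 : ProperEquiv (coordHyperplanes (t + 1) × V)
      ((coordHyperplanes t × V) × puncture Set.univ ⊕ (Fin t → ℂ) × V) :=
    (ProperEquiv.of_homeomorph (coordHyperplanesHomeomorph t V)).trans <|
    (ProperEquiv.detach hA isClosedCone_univ (isEscapingFlow_diagonal t)).trans <|
    .of_homeomorph (e.sumCongr (.refl _))
  refine h1.trans (ProperEquiv.sum (ProperEquiv.prod_puncture.trans (.of_homeomorph ?_)) (.refl _))
  exact (Homeomorph.prodAssoc _ _ _).sumCongr (Homeomorph.prodAssoc _ _ _)

end Induction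

end TorusComplement

namespace TorusComplement

open Set Filter Topology
open scoped ContinuousMap OnePoint

/-! ### Counting cells by Pascal's rule. -/

section Cells

/-- A disjoint union of Euclidean spaces of the given dimensions. -/
abbrev Cells {ι : Type*} (d : ι → ℕ) := Σ i, EuclideanSpace ℝ (Fin (d i))

/-- Reindexing a disjoint union of Euclidean spaces. -/
theorem nonempty_cells_homeomorph {ι ι' : Type*} {d : ι → ℕ} {d' : ι' → ℕ} (e : ι ≃ ι')
    (h : ∀ i, d' (e i) = d i) : Nonempty (Cells d ≃ₜ Cells d') := by
  obtain rfl : (fun i => d' (e i)) = d := funext h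
  refine ⟨(Equiv.sigmaCongrLeft (β := fun i => EuclideanSpace ℝ (Fin (d' i)))
    e).toHomeomorphOfContinuousOpen ?_ ?_⟩
  · exact continuous_sigma fun i =>
      continuous_sigmaMk (σ := fun i => EuclideanSpace ℝ (Fin (d' i))) (i := e i)
  · exact isOpenMap_sigma.2 fun i =>
      isOpenMap_sigmaMk (σ := fun i => EuclideanSpace ℝ (Fin (d' i))) (i := e i)

theorem nonempty_cells_sum_homeomorph {ι ι' : Type*} (d : ι ⊕ ι' → ℕ) :
    Nonempty (Cells (fun i => d (.inl i)) ⊕ Cells (fun i => d (.inr i)) ≃ₜ Cells d) := by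
  refine ⟨(Equiv.sumSigmaDistrib fun i =>
    EuclideanSpace ℝ (Fin (d i))).symm.toHomeomorphOfContinuousOpen ?_ ?_⟩
  · exact continuous_sum_dom.2 ⟨continuous_sigma fun i =>
      continuous_sigmaMk (σ := fun i => EuclideanSpace ℝ (Fin (d i))) (i := .inl i), continuous_sigma fun i =>
      continuous_sigmaMk (σ := fun i => EuclideanSpace ℝ (Fin (d i))) (i := .inr i)⟩
  · exact isOpenMap_sum.2 ⟨isOpenMap_sigma.2 fun i =>
      isOpenMap_sigmaMk (σ := fun i => EuclideanSpace ℝ (Fin (d i))) (i := .inl i), isOpenMap_sigma.2 fun i =>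
      isOpenMap_sigmaMk (σ := fun i => EuclideanSpace ℝ (Fin (d i))) (i := .inr i)⟩

theorem nonempty_cells_unit_homeomorph {V : Type*} [NormedAddCommGroup V] [NormedSpace ℝ V]
    [FiniteDimensional ℝ V] {m : ℕ} (h : Module.finrank ℝ V = m) :
    Nonempty (V ≃ₜ Cells fun _ : Unit => m) := by
  obtain ⟨e⟩ := FiniteDimensional.nonempty_continuousLinearEquiv_of_finrank_eq
    (𝕜 := ℝ) (E := V) (F := EuclideanSpace ℝ (Fin m)) (by simpa using h)
  exact ⟨{ toFun := fun v => ⟨(), e v⟩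
           invFun := fun p => e.symm p.2
           left_inv := fun v => by simp
           right_inv := fun p => by simp
           continuous_toFun := continuous_sigmaMk.comp e.continuous
           continuous_invFun := continuous_sigma fun _ => e.symm.continuous }⟩

/-- The index set of the cells: `t.choose (i + 1)` cells for every `i`. -/
abbrev CellIndex (t : ℕ) := Σ i : ℕ, Fin (t.choose (i + 1))

/-- Pascal's rule for the index set of the cells. -/
def cellIndexEquiv (t : ℕ) : (CellIndex t ⊕ CellIndex t) ⊕ Unit ≃ CellIndex (t + 1) where
  toFun := Sum.elim
    (Sum.elim
      (fun a => ⟨a.1 + 1, Fin.cast (Nat.choose_succ_succ t (a.1 + 1)).symm (Fin.castAdd _ a.2)⟩)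
      (fun a => ⟨a.1, Fin.cast (Nat.choose_succ_succ t a.1).symm (Fin.natAdd _ a.2)⟩))
    (fun _ => ⟨0, Fin.cast (Nat.choose_succ_succ t 0).symm
      (Fin.castAdd _ (Fin.cast (Nat.choose_zero_right t).symm 0))⟩)
  invFun
    | ⟨0, x⟩ => Fin.addCases (fun _ => .inr ()) (fun y => .inl (.inr ⟨0, y⟩))
        (Fin.cast (Nat.choose_succ_succ t 0) x)
    | ⟨i + 1, x⟩ => Fin.addCases (fun y => .inl (.inl ⟨i, y⟩)) (fun y => .inl (.inr ⟨i + 1, y⟩))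
        (Fin.cast (Nat.choose_succ_succ t (i + 1)) x)
  left_inv := by
    rintro ((⟨i, x⟩ | ⟨_ | i, x⟩) | _)
    · simp
    · simp
    · simp
    · simp
  right_inv := by
    rintro ⟨_ | i, x⟩
    · obtain ⟨y, rfl⟩ := (finCongr (Nat.choose_succ_succ t 0)).symm.surjective x
      induction y using Fin.addCases with
      | left y =>
        obtain ⟨y, rfl⟩ := (finCongr (Nat.choose_zero_right t)).symm.surjective y
        obtain rfl := Subsingleton.elim y 0
        simp
      | right y => simp
    · obtain ⟨y, rfl⟩ := (finCongr (Nat.choose_succ_succ t (i + 1))).symm.surjective x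
      induction y using Fin.addCases with
      | left y => simp
      | right y => simp

/-- The factor `V` varies because the recursion uses `V × ℝ` and `V × ℂ`. The former shifts the cell
index up by one, the latter keeps it, and `ℂ^t × V` is the new cell of index `0`. -/
theorem ProperEquiv.coordHyperplanes_cells (t : ℕ) : ∀ (V : Type) [NormedAddCommGroup V]
    [NormedSpace ℝ V] [FiniteDimensional ℝ V], ProperEquiv (coordHyperplanes t × V)
      (Cells fun a : CellIndex t => 2 * t + Module.finrank ℝ V - (a.1 + 2)) := by
  induction t with
  | zero =>
    intro V _ _ _
    have h1 : IsEmpty (coordHyperplanes 0 × V) := ⟨fun p => p.1.2.choose.elim0⟩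
    have h2 : IsEmpty (CellIndex 0) := ⟨fun a => by
      have := a.2.pos
      simp at this⟩
    have h3 : IsEmpty (Cells fun a : CellIndex 0 => 2 * 0 + Module.finrank ℝ V - (a.1 + 2)) :=
      ⟨fun p => h2.elim p.1⟩
    exact .of_homeomorph (Homeomorph.empty)
  | succ t ih =>
    intro V _ _ _
    have : ProperSpace V := FiniteDimensional.proper_real V
    have := (isClosed_coordHyperplanes t).locallyCompactSpace
    let d : (CellIndex t ⊕ CellIndex t) ⊕ Unit → ℕ := Sum.elim (Sum.elim
      (fun a => 2 * t + Module.finrank ℝ (V × ℝ) - (a.1 + 2))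
      (fun a => 2 * t + Module.finrank ℝ (V × ℂ) - (a.1 + 2)))
      (fun _ => 2 * t + Module.finrank ℝ V)
    obtain ⟨e₁⟩ := nonempty_cells_unit_homeomorph (V := (Fin t → ℂ) × V)
      (m := 2 * t + Module.finrank ℝ V) (by
        rw [Module.finrank_prod, Module.finrank_pi_fintype]
        simp [mul_comm])
    obtain ⟨e₂⟩ := nonempty_cells_sum_homeomorph fun i => d (.inl i)
    obtain ⟨e₃⟩ := nonempty_cells_sum_homeomorph d
    obtain ⟨e₄⟩ := nonempty_cells_homeomorph (d := d) (d' := fun a : CellIndex (t + 1) =>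
      2 * (t + 1) + Module.finrank ℝ V - (a.1 + 2)) (cellIndexEquiv t) (by
        rintro ((a | a) | a)
        · simp [d, cellIndexEquiv]
          omega
        · simp [d, cellIndexEquiv]
          omega
        · simp [d, cellIndexEquiv]
          omega)
    refine (ProperEquiv.coordHyperplanes_succ t V).trans <|
      (((ih (V × ℝ)).sum (ih (V × ℂ))).sum (.of_homeomorph e₁)).trans <|
      .of_homeomorph ((e₂.sumCongr (.refl _)).trans (e₃.trans e₄))

end Cells

end TorusComplement

namespace TorusComplement

open Set Filter Topology
open scoped ContinuousMap OnePoint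

/-! ### Wedges of spheres as compactifications. -/

section Wedge

/-- The sphere is the one-point compactification of Euclidean space, with the base point at
infinity. -/
theorem exists_onePoint_homeomorph_sphere (m : ℕ) :
    ∃ h : OnePoint (EuclideanSpace ℝ (Fin m)) ≃ₜ StdSphere m, h ∞ = basePt m := by
  let v : EuclideanSpace ℝ (Fin (m + 1)) := EuclideanSpace.single 0 1
  have hv : ‖v‖ = 1 := by simp [v]
  have hv₀ : v ≠ 0 := fun h => by simp [h] at hv
  have : Fact (Module.finrank ℝ (EuclideanSpace ℝ (Fin (m + 1))) = m + 1) := ⟨by simp⟩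
  obtain ⟨e⟩ := FiniteDimensional.nonempty_continuousLinearEquiv_of_finrank_eq
    (𝕜 := ℝ) (E := EuclideanSpace ℝ (Fin m)) (F := (Submodule.span ℝ {v})ᗮ)
    (by rw [Submodule.finrank_orthogonal_span_singleton (n := m) hv₀]; simp)
  refine ⟨e.toHomeomorph.onePointCongr.trans (onePointHyperplaneHomeoUnitSphere hv), ?_⟩
  change onePointHyperplaneHomeoUnitSphere hv ∞ = _
  exact OnePoint.equivOfIsEmbeddingOfRangeEq_apply_infty _ _ _ _

/-- A finite wedge of spheres is the one-point compactification of a disjoint union of Euclidean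
spaces. -/
theorem nonempty_wedge_homeomorph {ι : Type} [Finite ι] (d : ι → ℕ) :
    Nonempty (Wedge (X := fun a => StdSphere (d a)) (fun a => basePt (d a)) ≃ₜ
      OnePoint (Cells d)) := by
  choose h hh using exists_onePoint_homeomorph_sphere
  have hemb : ∀ i, IsClosedEmbedding fun v : EuclideanSpace ℝ (Fin (d i)) => (⟨i, v⟩ : Cells d) :=
    fun i => IsClosedEmbedding.sigmaMk (σ := fun i => EuclideanSpace ℝ (Fin (d i))) (i := i)
  let φ₀ : Unit ⊕ (Σ i, StdSphere (d i)) → OnePoint (Cells d) :=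
    Sum.elim (fun _ => ∞) fun x => onePointMap (hemb x.1) ((h (d x.1)).symm x.2)
  have hφ₀ : ∀ a b, WedgeRel (fun a => basePt (d a)) a b → φ₀ a = φ₀ b := by
    rintro _ _ ⟨i⟩
    simp [φ₀, ← hh]
  let ψ : OnePoint (Cells d) → Wedge (X := fun a => StdSphere (d a)) (fun a => basePt (d a)) :=
    fun p => p.elim (Quot.mk _ (.inl ())) fun x => Quot.mk _ (.inr ⟨x.1, h _ (x.2 : OnePoint _)⟩)
  let e : Wedge (X := fun a => StdSphere (d a)) (fun a => basePt (d a)) ≃ OnePoint (Cells d) :=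
    { toFun := Quot.lift φ₀ hφ₀
      invFun := ψ
      left_inv := by
        rintro ⟨⟨⟩ | ⟨i, x⟩⟩
        · rfl
        · obtain ⟨y, rfl⟩ := (h (d i)).surjective x
          induction y using OnePoint.rec with
          | infty =>
            have h1 : ψ (Quot.lift φ₀ hφ₀ (Quot.mk _ (.inr ⟨i, h (d i) ∞⟩))) =
                Quot.mk _ (.inl ()) := by simp [φ₀, ψ]
            refine h1.trans ?_
            rw [hh]
            exact (Quot.sound (.glue i)).symm
          | coe y => simp [φ₀, ψ]
      right_inv := by
        intro p
        induction p using OnePoint.rec with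
        | infty => rfl
        | coe p => simp [φ₀, ψ] }
  have he : Continuous e := by
    refine continuous_quot_lift _ (continuous_sum_dom.2 ⟨continuous_const, continuous_sigma ?_⟩)
    exact fun i => (map_continuous (onePointMap (hemb i))).comp (h (d i)).symm.continuous
  -- Finiteness of `ι` makes the wedge compact, so a continuous bijection to a Hausdorff space
  -- suffices.
  exact ⟨he.homeoOfEquivCompactToT2⟩

/-- The index sets of the cells and of the spheres in the wedge agree. -/
def sphereIndexEquiv (t : ℕ) : CellIndex t ≃ Σ i : Finset.Icc 1 t, Fin (t.choose i) where
  toFun a := ⟨⟨a.1 + 1, Finset.mem_Icc.2 ⟨by lia, by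
    by_contra h
    have := a.2.pos
    rw [Nat.choose_eq_zero_of_lt (by lia)] at this
    exact this.false⟩⟩, a.2⟩
  invFun a := ⟨a.1 - 1, Fin.cast (by
    rw [Nat.sub_add_cancel (Finset.mem_Icc.1 a.1.2).1]) a.2⟩
  left_inv _ := rfl
  right_inv := by
    rintro ⟨⟨_ | i, hi⟩, x⟩
    · simp at hi
    · rfl

/-- Cell index `a` corresponds to `i = a + 1` in the wedge, so `2n - 1 - i = 2n - (a + 2)`. -/
theorem nonempty_sphereWedge_homeomorph (n t : ℕ) :
    Nonempty (OnePoint (Cells fun a : CellIndex t => 2 * n - (a.1 + 2)) ≃ₜ SphereWedge n t) := by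
  obtain ⟨e⟩ := nonempty_wedge_homeomorph
    fun a : (Σ i : Finset.Icc 1 t, Fin (t.choose i)) => 2 * n - 1 - a.1
  obtain ⟨e'⟩ := nonempty_cells_homeomorph (d := fun a : CellIndex t => 2 * n - (a.1 + 2))
    (d' := fun a => 2 * n - 1 - a.1) (sphereIndexEquiv t) (fun a => by
      change 2 * n - 1 - (a.1 + 1) = _
      omega)
  exact ⟨e'.onePointCongr.trans e.symm⟩

end Wedge

/-! ### Stereographic projection of the hyperplane sections. -/

section Stereographic

variable {n : ℕ}

/-- The square of the Euclidean norm on `ℂⁿ × ℝ`. -/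
noncomputable def normSq (p : (Fin n → ℂ) × ℝ) : ℝ := ∑ j, ‖p.1 j‖ ^ 2 + p.2 ^ 2

/-- The points of the sphere with a vanishing coordinate in `J`. -/
def sphereHyperplanes (J : Finset (Fin n)) : Set ((Fin n → ℂ) × ℝ) :=
  {p | p ∈ evenSphere n ∧ ∃ j ∈ J, p.1 j = 0}

/-- The union of the hyperplanes `z j = 0` with `j ∈ J`. -/
def someHyperplanes (J : Finset (Fin n)) : Set (Fin n → ℂ) := {z | ∃ j ∈ J, z j = 0}

theorem isClosed_someHyperplanes (J : Finset (Fin n)) : IsClosed (someHyperplanes J) := by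
  have : someHyperplanes J = ⋃ j ∈ J, {z | z j = 0} := by
    ext; simp [someHyperplanes]
  rw [this]
  exact J.finite_toSet.isClosed_biUnion fun j _ => isClosed_eq (by fun_prop) (by fun_prop)

theorem isCompact_evenSphere : IsCompact (evenSphere n) := by
  refine Metric.isCompact_of_isClosed_isBounded ?_ ?_
  · exact isClosed_eq (by fun_prop) continuous_const
  · refine Metric.isBounded_iff_subset_closedBall 0 |>.2 ⟨1, fun p hp => ?_⟩
    have hp' : ∑ j, ‖p.1 j‖ ^ 2 + p.2 ^ 2 = 1 := hp
    have h0 : 0 ≤ ∑ j, ‖p.1 j‖ ^ 2 := by positivity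
    rw [mem_closedBall_zero_iff, norm_prod_le_iff, pi_norm_le_iff_of_nonneg one_pos.le]
    constructor
    · intro j
      have := Finset.single_le_sum (f := fun j => ‖p.1 j‖ ^ 2) (fun _ _ => by positivity)
        (Finset.mem_univ j)
      nlinarith [norm_nonneg (p.1 j), sq_nonneg p.2]
    · rw [Real.norm_eq_abs, abs_le_one_iff_mul_self_le_one]
      nlinarith

theorem isCompact_sphereHyperplanes (J : Finset (Fin n)) : IsCompact (sphereHyperplanes J) :=
  isCompact_evenSphere.inter_right
    ((isClosed_someHyperplanes J).preimage continuous_fst)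

/-- The pole of the sphere. -/
def pole {J : Finset (Fin n)} (hJ : J.Nonempty) : sphereHyperplanes J :=
  ⟨(0, 1), by simp [evenSphere], hJ.choose, hJ.choose_spec, rfl⟩

theorem snd_lt_one {p : (Fin n → ℂ) × ℝ} (hp : p ∈ evenSphere n) (h : p ≠ (0, 1)) : p.2 < 1 := by
  have hp' : ∑ j, ‖p.1 j‖ ^ 2 + p.2 ^ 2 = 1 := hp
  have h0 : 0 ≤ ∑ j, ‖p.1 j‖ ^ 2 := by positivity
  by_contra hc
  rw [not_lt] at hc
  have h1 : ∑ j, ‖p.1 j‖ ^ 2 = 0 := by nlinarith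
  have h2 : p.2 = 1 := by nlinarith
  refine h (Prod.ext (funext fun j => ?_) h2)
  have := (Finset.sum_eq_zero_iff_of_nonneg fun _ _ => by positivity).1 h1 j (Finset.mem_univ j)
  simpa using this

theorem sum_norm_smul_sq (c : ℝ) (z : Fin n → ℂ) :
    ∑ j, ‖(c • z) j‖ ^ 2 = c ^ 2 * ∑ j, ‖z j‖ ^ 2 := by
  rw [Finset.mul_sum]
  refine Finset.sum_congr rfl fun j _ => ?_
  rw [Pi.smul_apply, norm_smul, mul_pow, Real.norm_eq_abs, sq_abs]

/-- The stereographic projection. -/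
noncomputable def stereo {J : Finset (Fin n)} (hJ : J.Nonempty) :
    someHyperplanes J ≃ₜ {p : sphereHyperplanes J // p ≠ pole hJ} where
  toFun z := ⟨⟨((2 / (∑ j, ‖z.1 j‖ ^ 2 + 1)) • z.1,
      (∑ j, ‖z.1 j‖ ^ 2 - 1) / (∑ j, ‖z.1 j‖ ^ 2 + 1)), by
    have h0 : 0 < ∑ j, ‖z.1 j‖ ^ 2 + 1 := by positivity
    constructor
    · change ∑ j, ‖((2 / (∑ j, ‖z.1 j‖ ^ 2 + 1)) • z.1) j‖ ^ 2 + _ = 1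
      rw [sum_norm_smul_sq]
      field_simp
      ring
    · obtain ⟨j, hj, h⟩ := z.2
      exact ⟨j, hj, by simp [h]⟩⟩, by
    intro h
    have h0 : 0 < ∑ j, ‖z.1 j‖ ^ 2 + 1 := by positivity
    have h1 : (∑ j, ‖z.1 j‖ ^ 2 - 1) / (∑ j, ‖z.1 j‖ ^ 2 + 1) = 1 :=
      congrArg (fun p : sphereHyperplanes J => p.1.2) h
    rw [div_eq_one_iff_eq h0.ne'] at h1
    linarith⟩
  invFun p := ⟨(1 - p.1.1.2)⁻¹ • p.1.1.1, by
    obtain ⟨j, hj, h⟩ := p.1.2.2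
    exact ⟨j, hj, by simp [h]⟩⟩
  left_inv z := by
    have h0 : 0 < ∑ j, ‖z.1 j‖ ^ 2 + 1 := by positivity
    refine Subtype.ext ?_
    simp only [smul_smul]
    convert one_smul ℝ z.1 using 2
    rw [one_sub_div h0.ne']
    field_simp
    ring
  right_inv p := by
    have h1 : p.1.1.2 < 1 := snd_lt_one p.1.2.1 fun h => p.2 (Subtype.ext h)
    have h2 : 0 < 1 - p.1.1.2 := by linarith
    have h3 : ∑ j, ‖p.1.1.1 j‖ ^ 2 = 1 - p.1.1.2 ^ 2 := eq_sub_of_add_eq p.1.2.1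
    have h4 : ∑ j, ‖((1 - p.1.1.2)⁻¹ • p.1.1.1) j‖ ^ 2 = (1 + p.1.1.2) / (1 - p.1.1.2) := by
      rw [sum_norm_smul_sq, h3]
      field_simp
      ring
    refine Subtype.ext (Subtype.ext (Prod.ext ?_ ?_))
    · simp only [smul_smul, h4]
      convert one_smul ℝ p.1.1.1 using 2
      field_simp
      ring
    · simp only [h4]
      field_simp
      ring
  continuous_toFun := by
    refine Continuous.subtype_mk (Continuous.subtype_mk ?_ _) _
    have h0 : ∀ z : someHyperplanes J, ∑ j, ‖z.1 j‖ ^ 2 + 1 ≠ 0 := fun z => by positivity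
    have hN : Continuous fun z : someHyperplanes J => ∑ j, ‖z.1 j‖ ^ 2 :=
      (by fun_prop : Continuous fun z : Fin n → ℂ => ∑ j, ‖z j‖ ^ 2).comp continuous_subtype_val
    exact Continuous.prodMk ((Continuous.div (by fun_prop) (by fun_prop) h0).smul (by fun_prop))
      (Continuous.div (by fun_prop) (by fun_prop) h0)
  continuous_invFun := by
    refine Continuous.subtype_mk ?_ _
    have h0 : ∀ p : {p : sphereHyperplanes J // p ≠ pole hJ}, 1 - p.1.1.2 ≠ 0 := fun p => by
      have h1 : p.1.1.2 < 1 := snd_lt_one p.1.2.1 fun h => p.2 (Subtype.ext h)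
      linarith
    exact (Continuous.inv₀ (by fun_prop) h0).smul (by fun_prop)

/-- Stereographic projection multiplies `z` by a positive real, so it preserves vanishing
coordinates. The centre `(0, 1)` lies in the set because `J` is nonempty, and serves as `∞`. -/
theorem nonempty_onePoint_homeomorph_sphereHyperplanes {J : Finset (Fin n)} (hJ : J.Nonempty) :
    Nonempty (OnePoint (someHyperplanes J) ≃ₜ sphereHyperplanes J) := by
  have : CompactSpace (sphereHyperplanes J) :=
    isCompact_iff_compactSpace.1 (isCompact_sphereHyperplanes J)
  refine ⟨OnePoint.equivOfIsEmbeddingOfRangeEq (pole hJ) (fun z => (stereo hJ z).1)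
    (IsEmbedding.subtypeVal.comp (stereo hJ).isEmbedding) ?_⟩
  ext p
  constructor
  · rintro ⟨z, rfl⟩
    exact (stereo hJ z).2
  · intro hp
    exact ⟨(stereo hJ).symm ⟨p, hp⟩, by simp⟩

/-- Separating the coordinates in `J` from the others. -/
theorem nonempty_someHyperplanes_homeomorph (J : Finset (Fin n)) :
    Nonempty (someHyperplanes J ≃ₜ coordHyperplanes J.card × ({j // j ∉ J} → ℂ)) := by
  let e : {j // j ∈ J} ≃ Fin J.card := J.equivFin
  let h : (Fin n → ℂ) ≃ₜ (Fin J.card → ℂ) × ({j // j ∉ J} → ℂ) :=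
    (Homeomorph.piEquivPiSubtypeProd (· ∈ J) fun _ => ℂ).trans
      ((Homeomorph.piCongrLeft (Y := fun _ => ℂ) e).prodCongr (.refl _))
  have hh : ∀ z j, (h z).1 j = z (e.symm j) := by
    intro z j
    obtain ⟨i, rfl⟩ := e.surjective j
    simp [h, Homeomorph.piEquivPiSubtypeProd]
  have hs : someHyperplanes J = h ⁻¹' (hyperplanesProd J.card _) := by
    ext z
    constructor
    · rintro ⟨j, hj, hz⟩
      exact ⟨e ⟨j, hj⟩, by simpa [hh] using hz⟩
    · rintro ⟨j, hj⟩
      exact ⟨_, (e.symm j).2, (hh z j).symm.trans hj⟩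
  exact ⟨(h.sets hs).trans (hyperplanesProdHomeomorph _ _)⟩

theorem nonempty_homotopyEquiv_sphereHyperplanes {J : Finset (Fin n)} (hJ : J.Nonempty) :
    Nonempty (sphereHyperplanes J ≃ₕ SphereWedge n J.card) := by
  obtain ⟨e₁⟩ := nonempty_onePoint_homeomorph_sphereHyperplanes hJ
  obtain ⟨e₂⟩ := nonempty_someHyperplanes_homeomorph J
  obtain ⟨e₃⟩ := nonempty_sphereWedge_homeomorph n J.card
  have hd : 2 * J.card + Module.finrank ℝ ({j // j ∉ J} → ℂ) = 2 * n := by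
    have h1 : Fintype.card {j // j ∉ J} = n - J.card := by simp [Fintype.card_subtype_compl]
    have h2 : J.card ≤ n := by simpa using J.card_le_univ
    rw [Module.finrank_pi_fintype]
    simp only [Complex.finrank_real_complex, Finset.sum_const, Finset.card_univ, h1]
    simp
    omega
  -- The unconstrained coordinates outside `J` play the role of `V`.
  have h := ProperEquiv.coordHyperplanes_cells J.card ({j // j ∉ J} → ℂ)
  rw [hd] at h
  obtain ⟨e₄⟩ := ((ProperEquiv.of_homeomorph e₂).trans h).nonempty_homotopyEquiv
  exact ⟨e₁.symm.toHomotopyEquiv.trans (e₄.trans e₃.toHomotopyEquiv)⟩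

end Stereographic

end TorusComplement

namespace TorusComplement

open Set Filter Topology
open scoped ContinuousMap unitInterval

/-! ### Identifying U([n], k). -/

section Faces

/-- The last coordinates, starting from the `k`-th. -/
def lastIndices (n k : ℕ) : Finset (Fin n) := {j | k ≤ (j : ℕ) + 1}

theorem card_lastIndices {n k : ℕ} (hk : 1 ≤ k) : (lastIndices n k).card = n + 1 - k := by
  have : (lastIndices n k).map Fin.valEmbedding = Finset.Ico (k - 1) n := by
    ext i
    simp only [lastIndices, Finset.mem_map, Finset.mem_filter, Finset.mem_univ, true_and,
      Fin.valEmbedding_apply, Finset.mem_Ico]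
    constructor
    · rintro ⟨j, hj, rfl⟩
      exact ⟨by omega, j.2⟩
    · rintro ⟨h1, h2⟩
      exact ⟨⟨i, h2⟩, by simp only; omega, rfl⟩
  rw [← Finset.card_map, this, Nat.card_Ico]
  omega

theorem single_mem_edge {n : ℕ} (j : Fin n) :
    ((Pi.single j 1, 0) : (Fin n → ℝ) × ℝ) ∈ edge j := by
  refine ⟨⟨?_, ?_⟩, ?_⟩
  · simp [Pi.single_apply, ite_pow]
  · intro i
    by_cases h : i = j
    · subst h; simp
    · simp [h]
  · intro i h
    simp [h]

/-- The preimage of the union of faces consists of the points of the sphere with a vanishing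
coordinate among the last ones. -/
theorem U_eq_sphereHyperplanes {n k : ℕ} (hk : 1 ≤ k) (hkn : k ≤ n) :
    U n k = sphereHyperplanes (lastIndices n k) := by
  ext p
  refine and_congr_right fun hp => ?_
  constructor
  · rintro ⟨F, ⟨hF, hE⟩, hpF⟩
    have hE := hE hk
    rcases hF with rfl | ⟨K, -, -, rfl⟩ | hF
    · exact absurd (fun j _ y hy => hy.1) hE
    -- Otherwise `K` contains none of the last indices, and then the face contains every edge `E_k,
    -- …, E_n`.
    · by_contra hc
      refine hE fun j hj y hy => ⟨hy.1, fun i hi => hy.2 i ?_⟩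
      rintro rfl
      exact hc ⟨i, by simpa [lastIndices] using hj, by simpa [orbitMap] using hpF.2 i hi⟩
    · have h0 : (orbitMap n p).1 = 0 := by
        rcases hF with rfl | rfl <;> exact congrArg Prod.fst hpF
      refine ⟨⟨n - 1, by omega⟩, ?_, ?_⟩
      · simp [lastIndices]
        omega
      · simpa [orbitMap] using congrFun h0 ⟨n - 1, by omega⟩
  · rintro ⟨j, hj, hz⟩
    have hj' : k ≤ (j : ℕ) + 1 := by simpa [lastIndices] using hj
    -- For `n > 1` the facet `x_j = 0` is used. For `n = 1` there are no such facets, and the point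
    -- must lie over one of the two vertices.
    by_cases hn : 1 < n
    · refine ⟨_, ⟨Or.inr (Or.inl ⟨{j}, by simp, by simpa using hn, rfl⟩), fun _ h => ?_⟩,
        ⟨⟨?_, fun i => norm_nonneg _⟩, ?_⟩⟩
      · have := (h j hj' (single_mem_edge j)).2 j (by simp)
        simp at this
      · exact hp
      · simpa [orbitMap] using hz
    · obtain rfl : n = 1 := by omega
      have hz' : p.1 = 0 := funext fun i => by rw [Subsingleton.elim i j, hz]; rfl
      have hx : p.2 ^ 2 = 1 := by
        have : ∑ j, ‖p.1 j‖ ^ 2 + p.2 ^ 2 = 1 := hp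
        simpa [hz'] using this
      have key : ∀ x : ℝ, ¬ ∀ j : Fin 1, k ≤ (j : ℕ) + 1 →
          edge j ⊆ ({(0, x)} : Set ((Fin 1 → ℝ) × ℝ)) := fun x h => by
        have := congrFun (congrArg Prod.fst (h j hj' (single_mem_edge j))) j
        simp at this
      have h0 : (orbitMap 1 p).1 = 0 := by
        ext i
        simp [orbitMap, hz']
      rcases sq_eq_one_iff.1 hx with hx | hx
      · exact ⟨_, ⟨Or.inr (Or.inr (Or.inl rfl)), fun _ => key 1⟩, Prod.ext h0 hx⟩
      · exact ⟨_, ⟨Or.inr (Or.inr (Or.inr rfl)), fun _ => key (-1)⟩, Prod.ext h0 hx⟩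

end Faces

/-! ### Deforming the complement of an orbit. -/

section Retraction

variable {n : ℕ}

theorem mem_torusOrbit_iff {p q : (Fin n → ℂ) × ℝ} :
    q ∈ torusOrbit p ↔ (∀ j, ‖q.1 j‖ = ‖p.1 j‖) ∧ q.2 = p.2 := by
  constructor
  · rintro ⟨t, rfl⟩
    exact ⟨fun j => by simp only [torusAct, norm_mul, Circle.norm_coe, one_mul], rfl⟩
  · rintro ⟨h, hx⟩
    have h1 : ∀ j, ∃ c : Circle, (c : ℂ) * p.1 j = q.1 j := by
      intro j
      by_cases hj : p.1 j = 0
      · refine ⟨1, ?_⟩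
        have := h j
        rw [hj, norm_zero, norm_eq_zero] at this
        simp [hj, this]
      · refine ⟨⟨q.1 j / p.1 j, ?_⟩, ?_⟩
        · refine mem_sphere_zero_iff_norm.2 ?_
          rw [norm_div, h j, div_self (norm_ne_zero_iff.2 hj)]
        · simp [hj]
    choose c hc using h1
    exact ⟨c, Prod.ext (funext hc) hx.symm⟩

/-- The nonvanishing coordinates of a point. -/
noncomputable def support (p : (Fin n → ℂ) × ℝ) : Finset (Fin n) := {j | p.1 j ≠ 0}

theorem card_support (p : (Fin n → ℂ) × ℝ) : (support p).card = orbitDim p := by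
  rw [orbitDim, ← Set.ncard_coe_finset]
  congr 1
  ext j
  simp [support]

variable {p : (Fin n → ℂ) × ℝ}

theorem mem_support {j : Fin n} : j ∈ support p ↔ p.1 j ≠ 0 := by simp [support]

/-- The largest multiple of the moduli of `p` that can be subtracted from those of `q`. -/
noncomputable def excess (h : (support p).Nonempty) (q : (Fin n → ℂ) × ℝ) : ℝ :=
  (support p).inf' h fun j => ‖q.1 j‖ / ‖p.1 j‖

theorem continuous_excess (h : (support p).Nonempty) : Continuous (excess h) :=
  Continuous.finset_inf'_apply h fun j _ => by fun_prop

theorem excess_nonneg (h : (support p).Nonempty) (q : (Fin n → ℂ) × ℝ) : 0 ≤ excess h q :=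
  (Finset.le_inf'_iff h _).2 fun j _ => by positivity

theorem excess_mul_le (h : (support p).Nonempty) (q : (Fin n → ℂ) × ℝ) (j : Fin n) :
    excess h q * ‖p.1 j‖ ≤ ‖q.1 j‖ := by
  by_cases hj : p.1 j = 0
  · simp [hj]
  · rw [← le_div_iff₀ (norm_pos_iff.2 hj)]
    exact Finset.inf'_le (fun j => ‖q.1 j‖ / ‖p.1 j‖) (mem_support.2 hj)

theorem exists_excess_mul_eq (h : (support p).Nonempty) (q : (Fin n → ℂ) × ℝ) :
    ∃ j ∈ support p, excess h q * ‖p.1 j‖ = ‖q.1 j‖ := by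
  obtain ⟨j, hj, hq⟩ := Finset.exists_mem_eq_inf' h fun j => ‖q.1 j‖ / ‖p.1 j‖
  refine ⟨j, hj, ?_⟩
  rw [excess, hq, div_mul_cancel₀ _ (norm_ne_zero_iff.2 (mem_support.1 hj))]

theorem excess_eq_zero (h : (support p).Nonempty) {q : (Fin n → ℂ) × ℝ}
    (hq : ∃ j ∈ support p, q.1 j = 0) : excess h q = 0 := by
  obtain ⟨j, hj, hz⟩ := hq
  have := excess_mul_le h q j
  rw [hz, norm_zero] at this
  have h1 : 0 < ‖p.1 j‖ := norm_pos_iff.2 (mem_support.1 hj)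
  nlinarith [excess_nonneg h q]

/-- The point `q`, moved away from the orbit of `p` along a straight line. -/
noncomputable def push (h : (support p).Nonempty) (t : ℝ) (q : (Fin n → ℂ) × ℝ) :
    (Fin n → ℂ) × ℝ :=
  (fun j => soft (t * excess h q * ‖p.1 j‖) (q.1 j), q.2 - t * excess h q * p.2)

theorem norm_push (h : (support p).Nonempty) {t : ℝ} (ht : t ∈ I) (q : (Fin n → ℂ) × ℝ)
    (j : Fin n) : ‖(push h t q).1 j‖ = ‖q.1 j‖ - t * excess h q * ‖p.1 j‖ := by
  have h0 := excess_nonneg h q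
  refine norm_soft_of_le (mul_nonneg (mul_nonneg ht.1 h0) (norm_nonneg _)) ?_
  refine le_trans ?_ (excess_mul_le h q j)
  exact mul_le_mul_of_nonneg_right (mul_le_of_le_one_left h0 ht.2) (norm_nonneg _)

theorem continuous_push (h : (support p).Nonempty) :
    Continuous fun x : ℝ × ((Fin n → ℂ) × ℝ) => push h x.1 x.2 := by
  have h1 : Continuous fun x : ℝ × ((Fin n → ℂ) × ℝ) => excess h x.2 :=
    (continuous_excess h).comp continuous_snd
  refine Continuous.prodMk (continuous_pi fun j => ?_) (by fun_prop)
  exact continuous_soft.comp (f := fun x : ℝ × ((Fin n → ℂ) × ℝ) =>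
    (x.1 * excess h x.2 * ‖p.1 j‖, x.2.1 j)) (by fun_prop)

/-- Only points of the orbit of `p` can be pushed to a multiple of a point of the orbit. -/
theorem mem_torusOrbit_of_push (hp : p ∈ evenSphere n) (h : (support p).Nonempty) {t c : ℝ}
    (ht : t ∈ I) (hc : 0 ≤ c) {q : (Fin n → ℂ) × ℝ} (hq : q ∈ evenSphere n)
    (h1 : ∀ j, ‖(push h t q).1 j‖ = c * ‖p.1 j‖) (h2 : (push h t q).2 = c * p.2) :
    q ∈ torusOrbit p := by
  -- Undoing the push makes `q`, in moduli and last coordinate, `a` times `p`; both have norm `1`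
  -- and `a ≥ 0`, so `a = 1`.
  set a := c + t * excess h q with ha
  have ha0 : 0 ≤ a := add_nonneg hc (mul_nonneg ht.1 (excess_nonneg h q))
  have h3 : ∀ j, ‖q.1 j‖ = a * ‖p.1 j‖ := fun j => by
    have := h1 j
    rw [norm_push h ht] at this
    linarith
  have h4 : q.2 = a * p.2 := by
    have : q.2 - t * excess h q * p.2 = c * p.2 := h2
    linarith
  have hp' : ∑ j, ‖p.1 j‖ ^ 2 + p.2 ^ 2 = 1 := hp
  have hq' : ∑ j, ‖q.1 j‖ ^ 2 + q.2 ^ 2 = 1 := hq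
  have h5 : a ^ 2 = 1 := by
    simp only [h3, h4, mul_pow, ← Finset.mul_sum, ← mul_add] at hq'
    rw [hp'] at hq'
    linarith
  have h6 : a = 1 := by nlinarith
  exact mem_torusOrbit_iff.2 ⟨fun j => by rw [h3, h6, one_mul], by rw [h4, h6, one_mul]⟩

/-- Radial projection to the sphere. -/
noncomputable def normalize (q : (Fin n → ℂ) × ℝ) : (Fin n → ℂ) × ℝ :=
  ((√(normSq q))⁻¹ • q.1, (√(normSq q))⁻¹ * q.2)

theorem normSq_nonneg (q : (Fin n → ℂ) × ℝ) : 0 ≤ normSq q := by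
  unfold normSq
  positivity

theorem normalize_mem {q : (Fin n → ℂ) × ℝ} (h : normSq q ≠ 0) : normalize q ∈ evenSphere n := by
  change ∑ j, ‖((√(normSq q))⁻¹ • q.1) j‖ ^ 2 + ((√(normSq q))⁻¹ * q.2) ^ 2 = 1
  rw [sum_norm_smul_sq, mul_pow, ← mul_add, inv_pow, Real.sq_sqrt (normSq_nonneg q)]
  exact inv_mul_cancel₀ h

theorem normalize_of_mem {q : (Fin n → ℂ) × ℝ} (h : q ∈ evenSphere n) : normalize q = q := by
  have : normSq q = 1 := h
  simp [normalize, this]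

theorem continuousOn_normalize :
    ContinuousOn (normalize (n := n)) {q | normSq q ≠ 0} := by
  have h1 : Continuous fun q : (Fin n → ℂ) × ℝ => √(normSq q) := by
    unfold normSq
    fun_prop
  have h2 : ContinuousOn (fun q : (Fin n → ℂ) × ℝ => (√(normSq q))⁻¹) {q | normSq q ≠ 0} :=
    h1.continuousOn.inv₀ fun q hq => (Real.sqrt_ne_zero (normSq_nonneg q)).2 hq
  exact (h2.smul continuous_fst.continuousOn).prodMk (h2.mul continuous_snd.continuousOn)

/-- A vanishing push is the case `c = 0` of `mem_torusOrbit_of_push`. -/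
theorem normSq_push_ne_zero (hp : p ∈ evenSphere n) (h : (support p).Nonempty) {t : ℝ}
    (ht : t ∈ I) {q : (Fin n → ℂ) × ℝ} (hq : q ∈ evenSphere n \ torusOrbit p) :
    normSq (push h t q) ≠ 0 := by
  intro h0
  have h1 : 0 ≤ ∑ j, ‖(push h t q).1 j‖ ^ 2 := by positivity
  have h2 : ∑ j, ‖(push h t q).1 j‖ ^ 2 + (push h t q).2 ^ 2 = 0 := h0
  have h3 : ∑ j, ‖(push h t q).1 j‖ ^ 2 = 0 := by nlinarith [sq_nonneg (push h t q).2]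
  have h4 : (push h t q).2 ^ 2 = 0 := by linarith
  refine hq.2 (mem_torusOrbit_of_push hp h ht le_rfl hq.1 (fun j => ?_) ?_)
  · have := (Finset.sum_eq_zero_iff_of_nonneg fun _ _ => by positivity).1 h3 j (Finset.mem_univ j)
    simpa using this
  · simpa using h4

/-- Returning to the orbit is the case of `mem_torusOrbit_of_push` where `c` is the norm of the
pushed point. -/
theorem normalize_push_mem (hp : p ∈ evenSphere n) (h : (support p).Nonempty) {t : ℝ}
    (ht : t ∈ I) {q : (Fin n → ℂ) × ℝ} (hq : q ∈ evenSphere n \ torusOrbit p) :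
    normalize (push h t q) ∈ evenSphere n \ torusOrbit p := by
  have h0 := normSq_push_ne_zero hp h ht hq
  refine ⟨normalize_mem h0, fun hO => hq.2 ?_⟩
  have hs : 0 < √(normSq (push h t q)) :=
    Real.sqrt_pos.2 (lt_of_le_of_ne (normSq_nonneg _) h0.symm)
  obtain ⟨h1, h2⟩ := mem_torusOrbit_iff.1 hO
  refine mem_torusOrbit_of_push hp h ht hs.le hq.1 (fun j => ?_) ?_
  · rw [← h1 j]
    change _ = _ * ‖(√(normSq (push h t q)))⁻¹ • (push h t q).1 j‖
    rw [norm_smul, norm_inv, Real.norm_of_nonneg hs.le,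
      mul_inv_cancel_left₀ hs.ne']
  · rw [← h2, normalize, mul_inv_cancel_left₀ hs.ne']

theorem continuous_normalize_push (hp : p ∈ evenSphere n) (h : (support p).Nonempty) :
    Continuous fun x : I × ↥(evenSphere n \ torusOrbit p) => normalize (push h x.1 x.2) :=
  continuousOn_normalize.comp_continuous
    ((continuous_push h).comp
      (f := fun x : I × ↥(evenSphere n \ torusOrbit p) => ((x.1 : ℝ), x.2.1)) (by fun_prop))
    fun x => normSq_push_ne_zero hp h x.1.2 x.2.2

theorem normalize_push_one_mem (hp : p ∈ evenSphere n) (h : (support p).Nonempty)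
    {q : (Fin n → ℂ) × ℝ} (hq : q ∈ evenSphere n \ torusOrbit p) :
    normalize (push h 1 q) ∈ sphereHyperplanes (support p) := by
  refine ⟨(normalize_push_mem hp h unitInterval.one_mem hq).1, ?_⟩
  obtain ⟨j, hj, he⟩ := exists_excess_mul_eq h q
  refine ⟨j, hj, ?_⟩
  have : (push h 1 q).1 j = 0 := by
    rw [← norm_eq_zero, norm_push h unitInterval.one_mem, one_mul, he, sub_self]
  simp [normalize, this]

theorem push_eq_self (h : (support p).Nonempty) {t : ℝ} {q : (Fin n → ℂ) × ℝ}
    (hq : t * excess h q = 0) : push h t q = q := by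
  simp [push, hq]

theorem sphereHyperplanes_subset :
    sphereHyperplanes (support p) ⊆ evenSphere n \ torusOrbit p := by
  rintro q ⟨hq, j, hj, hz⟩
  refine ⟨hq, fun hO => mem_support.1 hj ?_⟩
  have := (mem_torusOrbit_iff.1 hO).1 j
  rwa [hz, norm_zero, eq_comm, norm_eq_zero] at this

/-- The complement of an orbit deforms to the union of the coordinate subspheres that it avoids. -/
theorem nonempty_homotopyEquiv_complement (hp : p ∈ evenSphere n) (h : (support p).Nonempty) :
    Nonempty (↥(evenSphere n \ torusOrbit p) ≃ₕ sphereHyperplanes (support p)) := by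
  have hc := continuous_normalize_push hp h
  let f : C(↥(evenSphere n \ torusOrbit p), sphereHyperplanes (support p)) :=
    ⟨fun q => ⟨normalize (push h 1 q), normalize_push_one_mem hp h q.2⟩,
      Continuous.subtype_mk (hc.comp (f := fun q => (1, q)) (by fun_prop)) _⟩
  let g : C(sphereHyperplanes (support p), ↥(evenSphere n \ torusOrbit p)) :=
    ⟨Set.inclusion sphereHyperplanes_subset, continuous_inclusion _⟩
  -- The homotopy is the normalized push by `t`. On the hyperplane sections the excess vanishes, so
  -- `f` restricts to the identity there.
  refine ⟨⟨f, g, .symm ⟨⟨⟨fun x => ⟨_, normalize_push_mem hp h x.1.2 x.2.2⟩,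
    hc.subtype_mk _⟩, ?_, ?_⟩⟩, ?_⟩⟩
  · intro q
    refine Subtype.ext ?_
    change normalize (push h (0 : I) q) = q
    rw [push_eq_self h (by simp), normalize_of_mem q.2.1]
  · intro q
    rfl
  · have : f.comp g = .id _ := by
      ext1 q
      refine Subtype.ext ?_
      change normalize (push h 1 q) = q
      rw [push_eq_self h (by rw [excess_eq_zero h q.2.2, mul_zero]), normalize_of_mem q.2.1]
    rw [this]

end Retraction

end TorusComplement

theorem lemmal2 (n k t : ℕ) (hk : 1 ≤ k) (hkn : k ≤ n) (ht : t = n + 1 - k) :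
    Nonempty (TorusComplement.U n k ≃ₕ TorusComplement.SphereWedge n t) ∧
    ∀ p ∈ TorusComplement.evenSphere n, TorusComplement.orbitDim p = t →
      Nonempty (↥(TorusComplement.evenSphere n \ TorusComplement.torusOrbit p) ≃ₕ
        TorusComplement.SphereWedge n t) := by
  -- Positivity of `t` makes the index set nonempty, so that the pole of the projection is
  -- available.
  have ht0 : 0 < t := by omega
  constructor
  · have hc : (TorusComplement.lastIndices n k).card = t :=
      (TorusComplement.card_lastIndices hk).trans ht.symm
    rw [TorusComplement.U_eq_sphereHyperplanes hk hkn, ← hc]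
    exact TorusComplement.nonempty_homotopyEquiv_sphereHyperplanes
      (Finset.card_pos.1 (hc ▸ ht0))
  · rintro p hp rfl
    rw [← TorusComplement.card_support] at ht0 ⊢
    have hs := Finset.card_pos.1 ht0
    obtain ⟨e₁⟩ := TorusComplement.nonempty_homotopyEquiv_complement hp hs
    obtain ⟨e₂⟩ := TorusComplement.nonempty_homotopyEquiv_sphereHyperplanes hs
    exact ⟨e₁.trans e₂⟩
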